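/- Let $0<a$, $a\neq 1$. There is a constant $C>0$ depending only on $a$ such that the following holds. For a tempered distribution $v$ on $\mathbb{R}$ and $s\in\mathbb{R}$ write $v\in\dot H^{s}$ if $\widehat v$ is a locally integrable function with $\|v\|_{\dot H^s}:=\|\,|D|^s v\|_{L^2}=\|\,|2\pi\xi|^{s}\,\widehat v(\xi)\|_{L^2_\xi}<\infty$, where $\widehat v(\xi)=\int e^{-2\pi i x\xi}v(x)\,dx$ and $|D|$ is the Fourier multiplier with symbol $|2\pi\xi|$. Let $u_0$ be a tempered distribution on $\mathbb{R}$, and let $Lu_0:=\frac{x}{a}\partial_x u_0$ (the value at $t=0$ of $Lu$ with $L=t\partial_t+\frac{x}{a}\partial_x$, where $u(t)=e^{it|D|^a}u_0$). Assume $$u_0\in\dot H^{\frac{1-a}{2}}\quad\text{and}\quad Lu_0\in\dot H^{\frac{1-a}{2}} .$$ Then for every $t>0$ the distribution $u(t)=e^{it|D|^a}u_0$, i.e. the one with $\widehat{u(t)}(\xi)=e^{it|2\pi\xi|^a}\widehat{u_0}(\xi)$, is a continuous function $u(t,\cdot)$ on $\mathbb{R}$, and $$|u(t,yt^{1/a})|\le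 C\left(1+|y|^{\frac{-a}{4(1-a)}}\right)t^{-1/2}\left(\|u_0\|_{\dot H^{\frac{1-a}{2}}}+\|Lu_0\|_{\dot H^{\frac{1-a}{2}}}\right)$$ for every $t>0$ and every $y\in\mathbb{R}$, where $y\neq 0$ is required if $a<1$. -/

import Mathlib

open MeasureTheory
open scoped SchwartzMap FourierTransform ENNReal

noncomputable section

/-- The tempered distribution `u` is (integration against) the locally integrable function `f`. -/
structure IsRepresentedBy (u : 𝓢'(ℝ, ℂ)) (f : ℝ → ℂ) : Prop where
  locallyIntegrable : LocallyIntegrable f volume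
  integrable : ∀ φ : 𝓢(ℝ, ℂ), Integrable (fun x => φ x * f x) volume
  apply_eq : ∀ φ : 𝓢(ℝ, ℂ), u φ = ∫ x, φ x * f x

/-- The Fourier transform of the tempered distribution `u` is the locally integrable function `F`.
The Fourier transform is normalised with kernel `exp (-2 * π * i * x * ξ)`, so that `|D|` is
multiplication by `|2 * π * ξ|` on the Fourier side. -/
def HasFourierDensity (u : 𝓢'(ℝ, ℂ)) (F : ℝ → ℂ) : Prop :=
  IsRepresentedBy (𝓕 u) F

/-- The homogeneous Sobolev norm `‖u‖_{Ḣ^s} = ‖ |2 π ξ|^s û ‖_{L²}`, with values in `[0, ∞]`. It is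
`∞` if `û` is not a locally integrable function. As `û` is unique up to null sets, the infimum
runs over at most one value. -/
def homSobolevENorm (s : ℝ) (u : 𝓢'(ℝ, ℂ)) : ℝ≥0∞ :=
  ⨅ (F : ℝ → ℂ) (_ : HasFourierDensity u F),
    eLpNorm (fun ξ : ℝ => ((|2 * Real.pi * ξ| ^ s : ℝ) : ℂ) * F ξ) 2 volume

/-- Membership in the homogeneous Sobolev space `Ḣ^s(ℝ)`. -/
def MemHomSobolev (s : ℝ) (u : 𝓢'(ℝ, ℂ)) : Prop :=
  homSobolevENorm s u < ∞

/-- The homogeneous Sobolev norm as a real number. -/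
def homSobolevNorm (s : ℝ) (u : 𝓢'(ℝ, ℂ)) : ℝ :=
  (homSobolevENorm s u).toReal

/-- The value at time `t = 0` of `L u`, where `L = t ∂_t + (x / a) ∂_x`: the distribution
`(x / a) ∂_x u₀`. -/
def scalingField (a : ℝ) (u₀ : 𝓢'(ℝ, ℂ)) : 𝓢'(ℝ, ℂ) :=
  ((1 / a : ℝ) : ℂ) •
    TemperedDistribution.smulLeftCLM ℂ (fun x : ℝ => (x : ℂ))
      (TemperedDistribution.derivCLM ℂ u₀)

/-- `v = e^{i t |D|^a} u₀`: the Fourier transform of `v` is `e^{i t |2 π ξ|^a}` times that of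
`u₀`. -/
def IsDispersiveFlow (a t : ℝ) (u₀ v : 𝓢'(ℝ, ℂ)) : Prop :=
  ∃ F : ℝ → ℂ, HasFourierDensity u₀ F ∧
    HasFourierDensity v
      (fun ξ : ℝ => Complex.exp (Complex.I * ((t * |2 * Real.pi * ξ| ^ a : ℝ) : ℂ)) * F ξ)

end

/-!
The proof shows more: the bound holds with a constant in place of the factor `1 + |y| ^ …`, so `u(t)`
is bounded by `C t ^ (-1 / 2)` times the norms, uniformly in space.

On the Fourier side the hypothesis on `(x / a) ∂ₓ u₀` says that the derivative of `ξ F(ξ)` is `-a G`,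
where `F` and `G` are the transforms of `u₀` and of `(x / a) ∂ₓ u₀`
(`HasFourierDensity.integral_deriv_smul`). So `F` has a representative with `ξ F(ξ)` absolutely
continuous away from the origin (`exists_ae_eq_primitive`), and the weighted `L²` bounds give
`F(ξ) = O(|ξ| ^ (a / 2 - 1))` (`IsHalfLineProfile.norm_le`). A dilation reduces everything to `t = 1`
and to integrals of `e ^ (i φ) F` over half-lines, with the phase `φ = x ξ + ξ ^ a`. Frequencies
below `1` are harmless by the pointwise bound.

For the others let `r = φ' / ξ ^ (a / 2 - 1)` be the normalized slope. The function
`w = -i e ^ (i φ) ξ ^ (-a / 2) r / (1 + r ^ 2)` satisfies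
`w' = e ^ (i φ) / ξ + O(ξ⁻¹ (1 + |r| ξ ^ (-a / 2)) / (1 + r ^ 2))`, with no singularity at the stationary
point `r = 0`. Integrating by parts against `ξ F(ξ)` leaves errors controlled by the integrals of
`ξ ^ (a / 2 - 1) / (1 + r ^ 2)` and `ξ⁻¹ |r| / (1 + r ^ 2)`. These are bounded uniformly in `x`
(`exists_integral_slope_le`), because `ξ r' = (1 - a / 2) r + a (a - 1) ξ ^ (a / 2)`, so that the first
one is, up to a multiple of the second, the increment of `arctan r` divided by `a (a - 1)`; here
`a ≠ 1` is used.

The resulting bound for the integral over `[A, B]` involves only the energy of `F` and `G` above `A`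
(`exists_norm_integral_phaseFactor_le`). Hence the truncated inverse Fourier integrals are uniformly
Cauchy (`exists_flow_limit`), their limit is continuous and bounded, and it represents
`e ^ (i t |D| ^ a) u₀` (`exists_isDispersiveFlow_of_tendsto`).
-/

/-! ### The normalized slope of the phase -/

section

open Set intervalIntegral

theorem hasDerivAt_rpow_div {ξ : ℝ} (hξ : 0 < ξ) (p : ℝ) :
    HasDerivAt (fun y : ℝ => y ^ p) (p * ξ ^ p / ξ) ξ := by
  have h := Real.hasDerivAt_rpow_const (x := ξ) (p := p) (Or.inl hξ.ne')
  rwa [Real.rpow_sub_one hξ.ne', ← mul_div_assoc] at h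

/-- The derivative `x + a ξ ^ (a - 1)` of the phase `x ξ + ξ ^ a`, divided by `ξ ^ (a / 2 - 1)`, which
is up to a constant the square root of the absolute value of the second derivative. The
stationary-phase region is where this quantity is bounded. -/
noncomputable def normalizedSlope (a x ξ : ℝ) : ℝ := x * ξ ^ (1 - a / 2) + a * ξ ^ (a / 2)

/-- The derivative of the normalized slope is again an expression in the slope itself. In the second
term the coefficient `a * (a - 1)` does not vanish: this is where `a ≠ 1` enters. -/
theorem hasDerivAt_normalizedSlope (a x : ℝ) {ξ : ℝ} (hξ : 0 < ξ) :
    HasDerivAt (normalizedSlope a x)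
      (((1 - a / 2) * normalizedSlope a x ξ + a * (a - 1) * ξ ^ (a / 2)) / ξ) ξ := by
  have h := ((hasDerivAt_rpow_div hξ (1 - a / 2)).const_mul x).add
    ((hasDerivAt_rpow_div hξ (a / 2)).const_mul a)
  refine h.congr_deriv ?_
  rw [normalizedSlope]
  ring

theorem continuousOn_normalizedSlope (a x : ℝ) :
    ContinuousOn (normalizedSlope a x) (Ioi 0) := fun _ hξ =>
  (hasDerivAt_normalizedSlope a x hξ).continuousAt.continuousWithinAt

theorem continuousOn_rpow_Ioi (p : ℝ) : ContinuousOn (fun ξ : ℝ => ξ ^ p) (Ioi 0) := fun _ hξ =>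
  (hasDerivAt_rpow_div hξ p).continuousAt.continuousWithinAt

theorem Icc_subset_Ioi_zero {A B : ℝ} (hA : 0 < A) : Icc A B ⊆ Ioi 0 := fun _ h => hA.trans_le h.1

theorem ContinuousOn.intervalIntegrable_of_pos {E : Type*} [NormedAddCommGroup E] {f : ℝ → E}
    (hf : ContinuousOn f (Ioi 0)) {A B : ℝ} (hA : 0 < A) (hAB : A ≤ B) :
    IntervalIntegrable f volume A B :=
  (hf.mono (Icc_subset_Ioi_zero hA)).intervalIntegrable_of_Icc hAB

theorem continuousOn_one_add_normalizedSlope_sq (a x : ℝ) :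
    ContinuousOn (fun ξ => 1 + normalizedSlope a x ξ ^ 2) (Ioi 0) :=
  continuousOn_const.add ((continuousOn_normalizedSlope a x).pow 2)

theorem continuousOn_slopeWeight (a x : ℝ) :
    ContinuousOn (fun ξ : ℝ => ξ ^ (a / 2) / ξ / (1 + normalizedSlope a x ξ ^ 2)) (Ioi 0) := by
  refine ContinuousOn.div (ContinuousOn.div (continuousOn_rpow_Ioi _) continuousOn_id
    fun ξ hξ => (ne_of_gt hξ))
    (continuousOn_one_add_normalizedSlope_sq a x) fun ξ _ => by positivity

theorem continuousOn_slopeRatio (a x : ℝ) :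
    ContinuousOn (fun ξ : ℝ => |normalizedSlope a x ξ| / ξ / (1 + normalizedSlope a x ξ ^ 2))
      (Ioi 0) := by
  refine ContinuousOn.div (ContinuousOn.div (continuousOn_normalizedSlope a x).abs continuousOn_id
    fun ξ hξ => (ne_of_gt hξ))
    (continuousOn_one_add_normalizedSlope_sq a x) fun ξ _ => by positivity

theorem integral_rpow_neg_div_le {p A B : ℝ} (hp : 0 < p) (hA : 1 ≤ A) (hAB : A ≤ B) :
    ∫ ξ in A..B, ξ ^ (-p) / ξ ≤ 1 / p := by
  have hA0 : 0 < A := by linarith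
  have hB0 : 0 < B := by linarith
  have h : ∫ ξ in A..B, ξ ^ (-p) / ξ = (-(1 / p) * B ^ (-p)) - (-(1 / p) * A ^ (-p)) := by
    refine integral_eq_sub_of_hasDerivAt (f := fun ξ : ℝ => -(1 / p) * ξ ^ (-p))
      (fun ξ hξ => ?_) ?_
    · rw [uIcc_of_le hAB] at hξ
      refine ((hasDerivAt_rpow_div (hA0.trans_le hξ.1) (-p)).const_mul (-(1 / p))).congr_deriv ?_
      field_simp
    · exact ContinuousOn.intervalIntegrable_of_pos ((continuousOn_rpow_Ioi _).div continuousOn_id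
        fun ξ hξ => (ne_of_gt hξ)) hA0 hAB
  have h1 : A ^ (-p) ≤ 1 := Real.rpow_le_one_of_one_le_of_nonpos hA (by linarith)
  have h2 : 0 ≤ B ^ (-p) := by positivity
  have h3 : 0 < 1 / p := by positivity
  rw [h]
  nlinarith

/-- With `r` the normalized slope, the integrals of `ξ ^ (a / 2 - 1) / (1 + r ^ 2)` and
`ξ⁻¹ |r| / (1 + r ^ 2)` over frequencies `ξ ≥ 1` are bounded uniformly in `x`. Integrating the
derivative of `arctan r`, which is bounded, expresses the first integral through the second; the
second is at most a small multiple of the first plus a convergent integral. -/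
theorem exists_integral_slope_le {a : ℝ} (ha : 0 < a) (ha1 : a ≠ 1) :
    ∃ C : ℝ, 0 < C ∧ ∀ x A B : ℝ, 1 ≤ A → A ≤ B →
      (∫ ξ in A..B, ξ ^ (a / 2) / ξ / (1 + normalizedSlope a x ξ ^ 2)) ≤ C ∧
      (∫ ξ in A..B, |normalizedSlope a x ξ| / ξ / (1 + normalizedSlope a x ξ ^ 2)) ≤ C := by
  set b := |a * (a - 1)| with hb
  have hb0 : 0 < b := abs_pos.2 (mul_ne_zero ha.ne' (sub_ne_zero.2 ha1))
  set d := |1 - a / 2| with hd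
  have hd0 : 0 ≤ d := abs_nonneg _
  -- The weight in Young's inequality, small enough for the first integral to be absorbed.
  set ε := b / (2 * (d + 1)) with hε
  have hε0 : 0 < ε := by positivity
  set M := 1 / (4 * ε) * (1 / (a / 2)) with hM
  have hM0 : 0 < M := by positivity
  set CJ := 2 / b * (Real.pi + d * M) with hCJ
  have hCJ0 : 0 < CJ := by positivity
  refine ⟨CJ + (ε * CJ + M), by positivity, fun x A B hA hAB => ?_⟩
  have hA0 : 0 < A := by linarith
  set r := normalizedSlope a x with hr
  set J := ∫ ξ in A..B, ξ ^ (a / 2) / ξ / (1 + r ξ ^ 2) with hJ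
  set K := ∫ ξ in A..B, |r ξ| / ξ / (1 + r ξ ^ 2) with hK
  have iJ : IntervalIntegrable (fun ξ => ξ ^ (a / 2) / ξ / (1 + r ξ ^ 2)) volume A B :=
    (continuousOn_slopeWeight a x).intervalIntegrable_of_pos hA0 hAB
  have iK : IntervalIntegrable (fun ξ => |r ξ| / ξ / (1 + r ξ ^ 2)) volume A B :=
    (continuousOn_slopeRatio a x).intervalIntegrable_of_pos hA0 hAB
  have iP : IntervalIntegrable (fun ξ : ℝ => ξ ^ (-(a / 2)) / ξ) volume A B :=
    ContinuousOn.intervalIntegrable_of_pos ((continuousOn_rpow_Ioi _).div continuousOn_id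
      fun ξ hξ => (ne_of_gt hξ)) hA0 hAB
  have hKJ : K ≤ ε * J + M := by
    have h1 : K ≤ ∫ ξ in A..B, (ε * (ξ ^ (a / 2) / ξ / (1 + r ξ ^ 2))
        + 1 / (4 * ε) * (ξ ^ (-(a / 2)) / ξ)) := by
      refine integral_mono_on hAB iK ((iJ.const_mul _).add (iP.const_mul _)) fun ξ hξ => ?_
      have hξ0 : 0 < ξ := hA0.trans_le hξ.1
      have hs : 0 < ξ ^ (a / 2) := by positivity
      rw [Real.rpow_neg hξ0.le]
      set s := ξ ^ (a / 2)
      have hq : 0 < 1 + r ξ ^ 2 := by positivity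
      have key : |r ξ| ≤ ε * s + 1 / (4 * ε) * s⁻¹ * (1 + r ξ ^ 2) := by
        have e1 : ε * s + 1 / (4 * ε) * s⁻¹ * (1 + r ξ ^ 2) - |r ξ|
            = ((2 * ε * s - |r ξ|) ^ 2 + 1) / (4 * ε * s) := by
          rw [← sq_abs (r ξ)]
          field_simp
          ring
        have : 0 ≤ ((2 * ε * s - |r ξ|) ^ 2 + 1) / (4 * ε * s) := by positivity
        linarith
      have e2 : ε * (s / ξ / (1 + r ξ ^ 2)) + 1 / (4 * ε) * (s⁻¹ / ξ)
          = (ε * s + 1 / (4 * ε) * s⁻¹ * (1 + r ξ ^ 2)) / ξ / (1 + r ξ ^ 2) := by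
        field_simp
      rw [e2]
      gcongr
    rw [integral_add (iJ.const_mul _) (iP.const_mul _), intervalIntegral.integral_const_mul,
      intervalIntegral.integral_const_mul] at h1
    have h2 := integral_rpow_neg_div_le (half_pos ha) hA hAB
    have h3 := mul_le_mul_of_nonneg_left h2 (show 0 ≤ 1 / (4 * ε) by positivity)
    linarith
  have hJK : b * J ≤ Real.pi + d * K := by
    set L := ∫ ξ in A..B, r ξ / ξ / (1 + r ξ ^ 2) with hL
    have iL : IntervalIntegrable (fun ξ => r ξ / ξ / (1 + r ξ ^ 2)) volume A B := by
      refine ContinuousOn.intervalIntegrable_of_pos (ContinuousOn.div (ContinuousOn.div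
        (continuousOn_normalizedSlope a x) continuousOn_id fun ξ hξ => (ne_of_gt hξ))
        (continuousOn_one_add_normalizedSlope_sq a x) fun ξ _ => by positivity) hA0 hAB
    have h1 : (1 - a / 2) * L + a * (a - 1) * J = Real.arctan (r B) - Real.arctan (r A) := by
      rw [hL, hJ, ← intervalIntegral.integral_const_mul, ← intervalIntegral.integral_const_mul,
        ← integral_add (iL.const_mul _) (iJ.const_mul _)]
      refine integral_eq_sub_of_hasDerivAt (f := fun ξ => Real.arctan (r ξ)) (fun ξ hξ => ?_)
        ((iL.const_mul _).add (iJ.const_mul _))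
      rw [uIcc_of_le hAB] at hξ
      have hξ0 : 0 < ξ := hA0.trans_le hξ.1
      refine (hasDerivAt_normalizedSlope a x hξ0).arctan.congr_deriv ?_
      change 1 / (1 + r ξ ^ 2) * (((1 - a / 2) * r ξ + a * (a - 1) * ξ ^ (a / 2)) / ξ) = _
      field_simp
    have h2 : |L| ≤ K := by
      refine (abs_integral_le_integral_abs hAB).trans (le_of_eq ?_)
      refine integral_congr fun ξ hξ => ?_
      rw [uIcc_of_le hAB] at hξ
      have hξ0 : 0 < ξ := hA0.trans_le hξ.1
      rw [abs_div, abs_div, abs_of_pos hξ0, abs_of_pos (show 0 < 1 + r ξ ^ 2 by positivity)]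
    have hJ0 : 0 ≤ J := integral_nonneg hAB fun ξ hξ => by
      have hξ0 : 0 < ξ := hA0.trans_le hξ.1
      positivity
    have h3 : b * J = |a * (a - 1) * J| := by rw [abs_mul, abs_of_nonneg hJ0]
    have h4 : |(1 - a / 2) * L| ≤ d * K := by
      rw [abs_mul]; gcongr
    rw [h3, show a * (a - 1) * J = (Real.arctan (r B) - Real.arctan (r A)) - (1 - a / 2) * L by
      linarith]
    refine (abs_sub _ _).trans (add_le_add ?_ h4)
    have := Real.arctan_lt_pi_div_two (r A)
    have := Real.arctan_lt_pi_div_two (r B)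
    have := Real.neg_pi_div_two_lt_arctan (r A)
    have := Real.neg_pi_div_two_lt_arctan (r B)
    rw [abs_le]; constructor <;> linarith
  have hJ0 : 0 ≤ J := integral_nonneg hAB fun ξ hξ => by
    have hξ0 : 0 < ξ := hA0.trans_le hξ.1
    positivity
  have hJC : J ≤ CJ := by
    have h1 : d * K ≤ d * (ε * J + M) := by gcongr
    have h2 : d * ε ≤ b / 2 := by
      rw [hε, ← mul_div_assoc, div_le_div_iff₀ (by positivity) (by positivity)]
      nlinarith
    have h3 : d * ε * J ≤ b / 2 * J := by gcongr
    have h4 : b / 2 * J ≤ Real.pi + d * M := by linarith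
    rw [hCJ, div_mul_eq_mul_div, le_div_iff₀ hb0]
    linarith
  constructor
  · have : 0 < ε * CJ := by positivity
    linarith
  · have : ε * J ≤ ε * CJ := by gcongr
    linarith

end

/-! ### Profiles on a half-line -/

section

open Set intervalIntegral

/-- Integration by parts against a primitive, by exchanging the order of integration over the
triangle `A ≤ η ≤ ξ ≤ B`. -/
theorem integral_deriv_mul_integral {A B : ℝ} (hAB : A ≤ B) {w w' g : ℝ → ℂ}
    (hw : ∀ ξ ∈ Icc A B, HasDerivAt w (w' ξ) ξ) (hw' : IntervalIntegrable w' volume A B)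
    (hg : IntervalIntegrable g volume A B) :
    ∫ ξ in A..B, w' ξ * ∫ η in A..ξ, g η = ∫ η in A..B, (w B - w η) * g η := by
  set μ := volume.restrict (Ioc A B) with hμ
  set S : Set (ℝ × ℝ) := {p | p.2 ≤ p.1} with hS
  have hSm : MeasurableSet S := measurableSet_le measurable_snd measurable_fst
  rw [intervalIntegrable_iff_integrableOn_Ioc_of_le hAB] at hw' hg
  have hint : Integrable (S.indicator fun p : ℝ × ℝ => w' p.1 * g p.2) (μ.prod μ) :=
    (Integrable.mul_prod (μ := μ) (ν := μ) hw' hg).indicator hSm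
  have hswap := integral_integral_swap
    (f := fun ξ η => S.indicator (fun p : ℝ × ℝ => w' p.1 * g p.2) (ξ, η)) hint
  rw [integral_of_le hAB, integral_of_le hAB]
  have h1 : ∫ ξ in Ioc A B, w' ξ * ∫ η in A..ξ, g η
      = ∫ ξ, ∫ η, S.indicator (fun p : ℝ × ℝ => w' p.1 * g p.2) (ξ, η) ∂μ ∂μ := by
    refine setIntegral_congr_fun measurableSet_Ioc fun ξ hξ => ?_
    have e : (fun η => S.indicator (fun p : ℝ × ℝ => w' p.1 * g p.2) (ξ, η))
        = (Iic ξ).indicator fun η => w' ξ * g η := by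
      ext η; simp [hS, indicator]
    simp only [e]
    rw [MeasureTheory.integral_indicator measurableSet_Iic, hμ,
      Measure.restrict_restrict measurableSet_Iic, inter_comm, Ioc_inter_Iic, min_eq_right hξ.2,
      MeasureTheory.integral_const_mul,
      integral_of_le hξ.1.le]
  have h2 : ∫ η in Ioc A B, (w B - w η) * g η
      = ∫ η, ∫ ξ, S.indicator (fun p : ℝ × ℝ => w' p.1 * g p.2) (ξ, η) ∂μ ∂μ := by
    refine setIntegral_congr_fun measurableSet_Ioc fun η hη => ?_
    have e : (fun ξ => S.indicator (fun p : ℝ × ℝ => w' p.1 * g p.2) (ξ, η))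
        = (Ici η).indicator fun ξ => w' ξ * g η := by
      ext ξ; simp [hS, indicator]
    simp only [e]
    have e2 : Ici η ∩ Ioc A B = Icc η B := by
      ext z; simp only [mem_inter_iff, mem_Ici, mem_Ioc, mem_Icc]
      exact ⟨fun h => ⟨h.1, h.2.2⟩, fun h => ⟨h.1, hη.1.trans_le h.1, h.2⟩⟩
    have e3 : ∫ ξ in η..B, w' ξ = w B - w η := by
      refine integral_eq_sub_of_hasDerivAt (fun ξ hξ => hw ξ ?_) ?_
      · rw [uIcc_of_le hη.2] at hξ
        exact ⟨hη.1.le.trans hξ.1, hξ.2⟩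
      · rw [intervalIntegrable_iff_integrableOn_Ioc_of_le hη.2]
        exact hw'.mono_set (Ioc_subset_Ioc_left hη.1.le)
    rw [MeasureTheory.integral_indicator measurableSet_Ici, hμ,
      Measure.restrict_restrict measurableSet_Ici, e2,
      integral_Icc_eq_integral_Ioc, ← integral_of_le hη.2, intervalIntegral.integral_mul_const, e3]
  rw [h1, h2, hswap]

/-- Integration by parts for a differentiable `w` and an absolutely continuous `H` with derivative
`g`; here `H` need not be differentiable everywhere. -/
theorem integral_deriv_mul_of_primitive {A B : ℝ} (hAB : A ≤ B) {w w' g H : ℝ → ℂ}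
    (hw : ∀ ξ ∈ Icc A B, HasDerivAt w (w' ξ) ξ) (hw' : IntervalIntegrable w' volume A B)
    (hg : IntervalIntegrable g volume A B)
    (hH : ∀ ξ ∈ Icc A B, H ξ = H A + ∫ η in A..ξ, g η) :
    ∫ ξ in A..B, w' ξ * H ξ = w B * H B - w A * H A - ∫ ξ in A..B, w ξ * g ξ := by
  have hgc : ContinuousOn (fun ξ => ∫ η in A..ξ, g η) (uIcc A B) :=
    continuousOn_primitive_interval' hg left_mem_uIcc
  have hwc : ContinuousOn w (uIcc A B) := fun ξ hξ => by
    rw [uIcc_of_le hAB] at hξ ⊢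
    exact (hw ξ hξ).continuousAt.continuousWithinAt
  have h1 : ∫ ξ in A..B, w' ξ * H ξ
      = ∫ ξ in A..B, (w' ξ * H A + w' ξ * ∫ η in A..ξ, g η) := by
    refine integral_congr fun ξ hξ => ?_
    rw [uIcc_of_le hAB] at hξ
    simp only [hH ξ hξ, mul_add]
  have h2 : ∫ ξ in A..B, w' ξ = w B - w A :=
    integral_eq_sub_of_hasDerivAt (fun ξ hξ => hw ξ (by rwa [uIcc_of_le hAB] at hξ)) hw'
  have h3 : ∫ η in A..B, (w B - w η) * g η
      = w B * (∫ η in A..B, g η) - ∫ η in A..B, w η * g η := by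
    rw [← intervalIntegral.integral_const_mul, ← integral_sub (hg.const_mul _)
      (hg.continuousOn_mul hwc)]
    simp only [sub_mul]
  rw [h1, integral_add (hw'.mul_const _) (hw'.mul_continuousOn hgc),
    intervalIntegral.integral_mul_const, h2, integral_deriv_mul_integral hAB hw hw' hg, h3,
    hH B ⟨hAB, le_rfl⟩]
  ring

/-- `f` is the restriction of a Fourier transform to the half-line `ξ > 0`, and `g` is the derivative
of `ξ f(ξ)`. The function `ξ f(ξ)` is absolutely continuous, which is expressed by the fundamental
theorem of calculus, and `f`, `g` are square integrable with the weight `ξ ^ (1 - a)` of the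
homogeneous Sobolev norm of order `(1 - a) / 2`. -/
structure IsHalfLineProfile (a : ℝ) (f g : ℝ → ℂ) : Prop where
  intervalIntegrable : ∀ A B : ℝ, 0 < A → A ≤ B → IntervalIntegrable g volume A B
  mul_eq : ∀ A B : ℝ, 0 < A → A ≤ B → B * f B = A * f A + ∫ ξ in A..B, g ξ
  integrableOn_left : IntegrableOn (fun ξ : ℝ => ξ ^ (1 - a) * ‖f ξ‖ ^ 2) (Ioi 0)
  integrableOn_right : IntegrableOn (fun ξ : ℝ => ξ ^ (1 - a) * ‖g ξ‖ ^ 2) (Ioi 0)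

/-- The square of the weighted `L²` norms of `f` and `g` over the frequencies above `A`. -/
noncomputable def tailEnergy (a : ℝ) (f g : ℝ → ℂ) (A : ℝ) : ℝ :=
  (∫ ξ in Ioi A, ξ ^ (1 - a) * ‖f ξ‖ ^ 2) + ∫ ξ in Ioi A, ξ ^ (1 - a) * ‖g ξ‖ ^ 2

namespace IsHalfLineProfile

variable {a : ℝ} {f g : ℝ → ℂ}

theorem continuousOn (h : IsHalfLineProfile a f g) : ContinuousOn f (Ioi 0) := by
  intro ξ hξ
  have hξ0 : 0 < ξ := hξ
  have hc : ContinuousOn (fun y => ∫ η in (ξ / 2)..y, g η) (uIcc (ξ / 2) (2 * ξ)) :=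
    continuousOn_primitive_interval' (h.intervalIntegrable _ _ (by linarith) (by linarith))
      left_mem_uIcc
  have hu : uIcc (ξ / 2) (2 * ξ) = Icc (ξ / 2) (2 * ξ) := uIcc_of_le (by linarith)
  have hn : Icc (ξ / 2) (2 * ξ) ∈ nhds ξ := Icc_mem_nhds (by linarith) (by linarith)
  rw [hu] at hc
  have h1 : ContinuousAt (fun y : ℝ => ((ξ / 2 : ℝ) * f (ξ / 2) + ∫ η in (ξ / 2)..y, g η) / (y : ℂ))
      ξ := by
    refine ContinuousAt.div (continuousAt_const.add (hc.continuousAt hn))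
      Complex.continuous_ofReal.continuousAt (by exact_mod_cast hξ0.ne')
  refine ContinuousAt.continuousWithinAt (h1.congr ?_)
  filter_upwards [hn] with y hy
  have hy0 : 0 < y := by linarith [hy.1]
  rw [← h.mul_eq _ _ (by linarith) hy.1]
  have : (y : ℂ) ≠ 0 := by exact_mod_cast hy0.ne'
  field_simp

theorem weighted_integral_le (h : IsHalfLineProfile a f g) {A N : ℝ} (hA : 0 ≤ A)
    (hE : tailEnergy a f g A ≤ N ^ 2) {α β : ℝ} (hα : A ≤ α) (hαβ : α ≤ β) :
    (∫ ξ in α..β, ξ ^ (1 - a) * ‖f ξ‖ ^ 2) + (∫ ξ in α..β, ξ ^ (1 - a) * ‖g ξ‖ ^ 2) ≤ N ^ 2 := by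
  refine le_trans ?_ hE
  rw [integral_of_le hαβ, integral_of_le hαβ, tailEnergy]
  have hs : Ioc α β ⊆ Ioi A := fun ξ hξ => hα.trans_lt hξ.1
  have hs' : Ioi A ⊆ Ioi 0 := Ioi_subset_Ioi hA
  have hpos : ∀ u : ℝ → ℂ, 0 ≤ᵐ[volume.restrict (Ioi A)] fun ξ => ξ ^ (1 - a) * ‖u ξ‖ ^ 2 := by
    intro u
    filter_upwards [ae_restrict_mem measurableSet_Ioi] with ξ hξ
    have : 0 < ξ := hs' hξ
    simp only [Pi.zero_apply]
    positivity
  exact add_le_add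
    (setIntegral_mono_set (h.integrableOn_left.mono_set hs') (hpos f) hs.eventuallyLE)
    (setIntegral_mono_set (h.integrableOn_right.mono_set hs') (hpos g) hs.eventuallyLE)

theorem intervalIntegrable_left (h : IsHalfLineProfile a f g) {α β : ℝ} (hα : 0 ≤ α)
    (hαβ : α ≤ β) : IntervalIntegrable (fun ξ : ℝ => ξ ^ (1 - a) * ‖f ξ‖ ^ 2) volume α β := by
  rw [intervalIntegrable_iff_integrableOn_Ioc_of_le hαβ]
  exact h.integrableOn_left.mono_set fun ξ hξ => hα.trans_lt hξ.1

theorem intervalIntegrable_right (h : IsHalfLineProfile a f g) {α β : ℝ} (hα : 0 ≤ α)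
    (hαβ : α ≤ β) : IntervalIntegrable (fun ξ : ℝ => ξ ^ (1 - a) * ‖g ξ‖ ^ 2) volume α β := by
  rw [intervalIntegrable_iff_integrableOn_Ioc_of_le hαβ]
  exact h.integrableOn_right.mono_set fun ξ hξ => hα.trans_lt hξ.1

end IsHalfLineProfile

theorem integral_rpow_div_eq {p A B : ℝ} (hp : 0 < p) (hA : 0 < A) (hAB : A ≤ B) :
    ∫ ξ in A..B, ξ ^ p / ξ = (B ^ p - A ^ p) / p := by
  rw [integral_eq_sub_of_hasDerivAt (f := fun ξ : ℝ => 1 / p * ξ ^ p)]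
  · ring
  · intro ξ hξ
    rw [uIcc_of_le hAB] at hξ
    refine ((hasDerivAt_rpow_div (hA.trans_le hξ.1) p).const_mul (1 / p)).congr_deriv ?_
    field_simp
  · exact ContinuousOn.intervalIntegrable_of_pos ((continuousOn_rpow_Ioi _).div continuousOn_id
      fun ξ hξ => (ne_of_gt hξ)) hA hAB

/-- Young's inequality with weights `p`, `q = 1 / p` and a free scale `N`. It replaces the
Cauchy–Schwarz inequality in the estimates below, where `N` bounds a square root of the energy. -/
theorem mul_le_weighted_sq {y z p q N : ℝ} (hN : 0 < N) (hp : 0 < p) (hpq : p * q = 1) :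
    y * z ≤ (q * y ^ 2 * N + p * z ^ 2 / N) / 2 := by
  have hq : 0 < q := (pos_iff_pos_of_mul_pos (hpq ▸ one_pos)).1 hp
  have : (q * y ^ 2 * N + p * z ^ 2 / N) / 2 - y * z = q * (y * N - p * z) ^ 2 / (2 * N) := by
    have hq' : q = 1 / p := by field_simp; linarith
    rw [hq']
    field_simp
    ring
  have h2 : 0 ≤ q * (y * N - p * z) ^ 2 / (2 * N) := by positivity
  linarith

theorem one_add_two_rpow_sub_one_div_pos {a : ℝ} (ha : 0 < a) :
    0 < 1 + 2 * (((2 : ℝ) ^ a - 1) / a) := by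
  have : (1 : ℝ) ≤ 2 ^ a := Real.one_le_rpow (by norm_num) ha.le
  have : 0 ≤ ((2 : ℝ) ^ a - 1) / a := div_nonneg (by linarith) ha.le
  positivity

/-- The pointwise bound `f(ξ) = O(N ξ ^ (a / 2 - 1))`, a one-dimensional Sobolev embedding. -/
theorem IsHalfLineProfile.norm_le {a : ℝ} {f g : ℝ → ℂ} (ha : 0 < a) (h : IsHalfLineProfile a f g)
    {A N ξ : ℝ} (hN : 0 < N) (hA : 0 ≤ A) (hE : tailEnergy a f g A ≤ N ^ 2) (hξ0 : 0 < ξ)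
    (hξ : A ≤ ξ) : ξ * ‖f ξ‖ ≤ (1 + 2 * ((2 ^ a - 1) / a)) * N * ξ ^ (a / 2) := by
  have hle : ξ ≤ 2 * ξ := by linarith
  have hgi := h.intervalIntegrable ξ (2 * ξ) hξ0 hle
  have hfi : IntervalIntegrable f volume ξ (2 * ξ) :=
    h.continuousOn.intervalIntegrable_of_pos hξ0 hle
  set If := ∫ η in ξ..(2 * ξ), ‖f η‖ with hIf
  set Ig := ∫ η in ξ..(2 * ξ), ‖g η‖ with hIg
  -- Averaging `ξ f(ξ) = η f(η) - ∫ g` over `η ∈ [ξ, 2ξ]`.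
  have h1 : ∀ η ∈ Icc ξ (2 * ξ), ξ * ‖f ξ‖ ≤ 2 * ξ * ‖f η‖ + Ig := by
    intro η hη
    have hm := h.mul_eq ξ η hξ0 hη.1
    have h2 : ‖∫ z in ξ..η, g z‖ ≤ Ig := by
      refine (intervalIntegral.norm_integral_le_integral_norm hη.1).trans ?_
      refine integral_mono_interval le_rfl hη.1 hη.2 (Filter.Eventually.of_forall fun z => ?_)
        hgi.norm
      simp
    have h3 : ξ * ‖f ξ‖ = ‖(ξ : ℂ) * f ξ‖ := by
      rw [norm_mul, Complex.norm_real, Real.norm_eq_abs, abs_of_pos hξ0]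
    have h4 : η * ‖f η‖ = ‖(η : ℂ) * f η‖ := by
      rw [norm_mul, Complex.norm_real, Real.norm_eq_abs, abs_of_pos (hξ0.trans_le hη.1)]
    have h5 : (ξ : ℂ) * f ξ = (η : ℂ) * f η - ∫ z in ξ..η, g z := by rw [hm]; ring
    have h6 : η * ‖f η‖ ≤ 2 * ξ * ‖f η‖ := by gcongr; exact hη.2
    rw [h3, h5]
    refine (norm_sub_le _ _).trans ?_
    rw [← h4]
    linarith
  have h2 : ξ * (ξ * ‖f ξ‖) ≤ 2 * ξ * If + ξ * Ig := by
    have := integral_mono_on hle (μ := volume) (f := fun _ => ξ * ‖f ξ‖)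
      (g := fun η => 2 * ξ * ‖f η‖ + Ig) (by simp) ((hfi.norm.const_mul _).add (by simp)) h1
    rw [integral_add (hfi.norm.const_mul _) (by simp), intervalIntegral.integral_const,
      intervalIntegral.integral_const, intervalIntegral.integral_const_mul, smul_eq_mul,
      smul_eq_mul] at this
    linarith
  have hIg0 : 0 ≤ Ig := integral_nonneg hle fun _ _ => norm_nonneg _
  have h3 : ξ * ‖f ξ‖ ≤ 2 * (If + Ig) := by
    have : ξ * (ξ * ‖f ξ‖) ≤ ξ * (2 * (If + Ig)) := by nlinarith
    exact le_of_mul_le_mul_left this hξ0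
  have hs : 0 < ξ ^ (a / 2) := by positivity
  set s := ξ ^ (a / 2) with hs_def
  have hss : ξ ^ a = s * s := by
    rw [hs_def, ← Real.rpow_add hξ0]; ring_nf
  have young : ∀ u : ℝ → ℂ, IntervalIntegrable u volume ξ (2 * ξ) →
      IntervalIntegrable (fun η : ℝ => η ^ (1 - a) * ‖u η‖ ^ 2) volume ξ (2 * ξ) →
      ∫ η in ξ..(2 * ξ), ‖u η‖ ≤ (N * s * ((2 ^ a - 1) / a)
        + s / N * ∫ η in ξ..(2 * ξ), η ^ (1 - a) * ‖u η‖ ^ 2) / 2 := by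
    intro u hu hu2
    have hp : IntervalIntegrable (fun η : ℝ => η ^ a / η) volume ξ (2 * ξ) :=
      ContinuousOn.intervalIntegrable_of_pos ((continuousOn_rpow_Ioi _).div continuousOn_id
        fun ξ hξ => (ne_of_gt hξ)) hξ0 hle
    have := integral_mono_on hle hu.norm
      (((hp.const_mul (N / (2 * s))).add (hu2.const_mul (s / (2 * N))))) fun η hη => ?_
    · refine this.trans (le_of_eq ?_)
      rw [integral_add (hp.const_mul _) (hu2.const_mul _), intervalIntegral.integral_const_mul,
        intervalIntegral.integral_const_mul, integral_rpow_div_eq ha hξ0 hle,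
        Real.mul_rpow (by norm_num) hξ0.le, hss]
      field_simp
    · have hη0 : 0 < η := hξ0.trans_le hη.1
      have e : η ^ (1 - a) * (η ^ a / η) = 1 := by
        rw [mul_div_assoc', ← Real.rpow_add hη0]; simp [hη0.ne']
      have := mul_le_weighted_sq (y := 1) (z := ‖u η‖) (p := η ^ (1 - a)) (q := η ^ a / η)
        (N := N / s) (by positivity) (by positivity) e
      rw [one_mul] at this
      refine this.trans (le_of_eq ?_)
      field_simp
  have yf := young f hfi (h.intervalIntegrable_left hξ0.le hle)
  have yg := young g hgi (h.intervalIntegrable_right hξ0.le hle)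
  have hw := h.weighted_integral_le hA hE hξ hle
  have hw' := mul_le_mul_of_nonneg_left hw (show 0 ≤ s / N by positivity)
  have e : s / N * N ^ 2 = N * s := by field_simp
  rw [e] at hw'
  nlinarith

end

/-! ### Uniform oscillatory integral estimates -/

section

open Set intervalIntegral

/-- The oscillating factor `e ^ (i (x ξ + ξ ^ a))`. -/
noncomputable def phaseFactor (a x ξ : ℝ) : ℂ := Complex.exp (Complex.I * ((x * ξ + ξ ^ a : ℝ) : ℂ))

theorem norm_phaseFactor (a x ξ : ℝ) : ‖phaseFactor a x ξ‖ = 1 := by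
  rw [phaseFactor, mul_comm, Complex.norm_exp_ofReal_mul_I]

theorem hasDerivAt_phaseFactor (a x : ℝ) {ξ : ℝ} (hξ : 0 < ξ) :
    HasDerivAt (phaseFactor a x)
      (phaseFactor a x ξ * (Complex.I * ((ξ ^ (a / 2) / ξ * normalizedSlope a x ξ : ℝ) : ℂ))) ξ := by
  have h : HasDerivAt (fun y : ℝ => x * y + y ^ a) (ξ ^ (a / 2) / ξ * normalizedSlope a x ξ) ξ := by
    refine (((hasDerivAt_id ξ).const_mul x).add (hasDerivAt_rpow_div hξ a)).congr_deriv ?_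
    have e1 : ξ ^ (1 - a / 2) = ξ / ξ ^ (a / 2) := by rw [Real.rpow_sub hξ, Real.rpow_one]
    have e2 : ξ ^ a = ξ ^ (a / 2) * ξ ^ (a / 2) := by rw [← Real.rpow_add hξ]; ring_nf
    have hs : 0 < ξ ^ (a / 2) := by positivity
    rw [normalizedSlope, e1, e2]
    field_simp
  exact (h.ofReal_comp.const_mul Complex.I).cexp

theorem continuousOn_phaseFactor (a x : ℝ) : ContinuousOn (phaseFactor a x) (Ioi 0) := fun _ hξ =>
  (hasDerivAt_phaseFactor a x hξ).continuousAt.continuousWithinAt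

/-- The function `r / (1 + r ^ 2) * ξ ^ (-a / 2)`, where `r` is the normalized slope. Multiplied by
`-i` and the phase factor, it is an approximate primitive of the phase factor divided by `ξ`, with
an error that remains integrable across the stationary point. -/
noncomputable def slopeAmplitude (a x ξ : ℝ) : ℝ :=
  normalizedSlope a x ξ / (1 + normalizedSlope a x ξ ^ 2) * ξ ^ (-(a / 2))

/-- The derivative of `slopeAmplitude`. -/
noncomputable def slopeAmplitudeDeriv (a x ξ : ℝ) : ℝ :=
  ((1 - normalizedSlope a x ξ ^ 2) / (1 + normalizedSlope a x ξ ^ 2) ^ 2 *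
    ((1 - a / 2) * normalizedSlope a x ξ + a * (a - 1) * ξ ^ (a / 2)) -
    a / 2 * (normalizedSlope a x ξ / (1 + normalizedSlope a x ξ ^ 2))) * ξ ^ (-(a / 2)) / ξ

theorem hasDerivAt_slopeAmplitude (a x : ℝ) {ξ : ℝ} (hξ : 0 < ξ) :
    HasDerivAt (slopeAmplitude a x) (slopeAmplitudeDeriv a x ξ) ξ := by
  have hr := hasDerivAt_normalizedSlope a x hξ
  have hq : 1 + normalizedSlope a x ξ ^ 2 ≠ 0 := by positivity
  refine ((hr.div ((hr.pow 2).const_add 1) hq).mul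
    (hasDerivAt_rpow_div hξ (-(a / 2)))).congr_deriv ?_
  rw [slopeAmplitudeDeriv]
  simp only [Pi.pow_apply, Pi.div_apply]
  field_simp
  push_cast
  ring

theorem continuousOn_slopeAmplitudeDeriv (a x : ℝ) :
    ContinuousOn (slopeAmplitudeDeriv a x) (Ioi 0) := by
  have hr := continuousOn_normalizedSlope a x
  have hq : ∀ ξ ∈ Ioi (0 : ℝ), 1 + normalizedSlope a x ξ ^ 2 ≠ 0 := fun ξ _ => by positivity
  have hq2 : ∀ ξ ∈ Ioi (0 : ℝ), (1 + normalizedSlope a x ξ ^ 2) ^ 2 ≠ 0 := fun ξ _ => by positivity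
  have h1 := continuousOn_rpow_Ioi (a / 2)
  have h2 := continuousOn_rpow_Ioi (-(a / 2))
  unfold slopeAmplitudeDeriv
  have h3 : ∀ ξ ∈ Ioi (0 : ℝ), ξ ≠ 0 := fun ξ hξ => ne_of_gt hξ
  fun_prop (disch := assumption)

theorem abs_slopeAmplitudeDeriv_le {a : ℝ} (ha : 0 < a) (x : ℝ) {ξ : ℝ} (hξ : 0 < ξ) :
    |slopeAmplitudeDeriv a x ξ| ≤ ((|1 - a / 2| + a / 2) * |normalizedSlope a x ξ|
      + |a * (a - 1)| * ξ ^ (a / 2)) * ξ ^ (-(a / 2)) / ξ / (1 + normalizedSlope a x ξ ^ 2) := by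
  set r := normalizedSlope a x ξ with hr
  have hs : 0 < ξ ^ (a / 2) := by positivity
  have hs' : 0 < ξ ^ (-(a / 2)) := by positivity
  have hq : 0 < 1 + r ^ 2 := by positivity
  have h1 : |(1 - r ^ 2) / (1 + r ^ 2) ^ 2| ≤ 1 / (1 + r ^ 2) := by
    rw [abs_div, abs_of_pos (show 0 < (1 + r ^ 2) ^ 2 by positivity), div_le_div_iff₀ (by positivity)
      hq]
    have : |1 - r ^ 2| ≤ 1 + r ^ 2 := by rw [abs_le]; constructor <;> nlinarith [sq_nonneg r]
    nlinarith
  have h2 : |(1 - a / 2) * r + a * (a - 1) * ξ ^ (a / 2)|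
      ≤ |1 - a / 2| * |r| + |a * (a - 1)| * ξ ^ (a / 2) := by
    refine (abs_add_le _ _).trans ?_
    rw [abs_mul, abs_mul (a * (a - 1)), abs_of_pos hs]
  have h3 : |a / 2 * (r / (1 + r ^ 2))| = a / 2 * |r| / (1 + r ^ 2) := by
    rw [abs_mul, abs_div r, abs_of_pos hq, abs_of_pos (half_pos ha), mul_div_assoc]
  rw [slopeAmplitudeDeriv, ← hr, abs_div, abs_mul, abs_of_pos hs', abs_of_pos hξ]
  have h4 := (abs_sub ((1 - r ^ 2) / (1 + r ^ 2) ^ 2 *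
    ((1 - a / 2) * r + a * (a - 1) * ξ ^ (a / 2))) (a / 2 * (r / (1 + r ^ 2))))
  rw [h3, abs_mul] at h4
  have h5 := mul_le_mul h1 h2 (abs_nonneg _) (by positivity)
  have h6 := h4.trans (add_le_add_left h5 _)
  have h7 := mul_le_mul_of_nonneg_right h6 hs'.le
  have h8 := div_le_div_of_nonneg_right h7 hξ.le
  refine h8.trans (le_of_eq ?_)
  field_simp
  ring

/-- Oscillatory integrals of a profile over frequencies above `1` are bounded uniformly in `x`, by
one integration by parts. No case distinction on the position of the stationary point is needed. -/
theorem exists_norm_integral_high_le {a : ℝ} (ha : 0 < a) (ha1 : a ≠ 1) :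
    ∃ C : ℝ, 0 < C ∧ ∀ f g : ℝ → ℂ, IsHalfLineProfile a f g → ∀ N A : ℝ, 0 < N → 0 ≤ A →
      tailEnergy a f g A ≤ N ^ 2 → ∀ x α β : ℝ, A ≤ α → 1 ≤ α → α ≤ β →
        ‖∫ ξ in α..β, phaseFactor a x ξ * f ξ‖ ≤ C * N := by
  obtain ⟨CJ, hCJ, hJ⟩ := exists_integral_slope_le ha ha1
  set P := 1 + 2 * (((2 : ℝ) ^ a - 1) / a) with hP
  have hP0 : 0 < P := one_add_two_rpow_sub_one_div_pos ha
  set d := |1 - a / 2| + a / 2 with hd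
  set b := |a * (a - 1)| with hb
  have hd0 : 0 ≤ d := by positivity
  have hb0 : 0 ≤ b := abs_nonneg _
  refine ⟨2 * P + (CJ + 1) / 2 + P * (d + b + 1) * CJ, by positivity, ?_⟩
  intro f g h N A hN hA hE x α β hAα hα hαβ
  obtain ⟨hJ1, hJ2⟩ := hJ x α β hα hαβ
  have hα0 : 0 < α := by linarith
  have hβ0 : 0 < β := by linarith
  set r := normalizedSlope a x with hr
  -- An approximate primitive of the phase factor divided by `ξ`.
  set w : ℝ → ℂ := fun ξ => phaseFactor a x ξ * (-Complex.I * (slopeAmplitude a x ξ : ℂ)) with hw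
  set w' : ℝ → ℂ := fun ξ => phaseFactor a x ξ *
    (((r ξ ^ 2 / (1 + r ξ ^ 2) / ξ : ℝ) : ℂ) - Complex.I * (slopeAmplitudeDeriv a x ξ : ℂ)) with hw'
  have hpos : ∀ ξ ∈ Icc α β, 0 < ξ := fun ξ hξ => hα0.trans_le hξ.1
  have hderiv : ∀ ξ ∈ Icc α β, HasDerivAt w (w' ξ) ξ := by
    intro ξ hξ
    have hξ0 := hpos ξ hξ
    refine ((hasDerivAt_phaseFactor a x hξ0).mul
      ((hasDerivAt_slopeAmplitude a x hξ0).ofReal_comp.const_mul (-Complex.I))).congr_deriv ?_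
    have e1 : ξ ^ (a / 2) / ξ * r ξ * slopeAmplitude a x ξ = r ξ ^ 2 / (1 + r ξ ^ 2) / ξ := by
      rw [slopeAmplitude, ← hr, Real.rpow_neg hξ0.le]
      have hs : 0 < ξ ^ (a / 2) := by positivity
      field_simp
    rw [hw']
    simp only [← e1, ← hr]
    push_cast
    linear_combination (-phaseFactor a x ξ * (((ξ ^ (a / 2) : ℝ) : ℂ) / (ξ : ℂ) * (r ξ : ℂ)) *
      (slopeAmplitude a x ξ : ℂ)) * Complex.I_sq
  have hrc := continuousOn_normalizedSlope a x
  have hidc : ContinuousOn (fun ξ : ℝ => ξ) (Ioi 0) := continuousOn_id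
  have hne : ∀ ξ ∈ Ioi (0 : ℝ), ξ ≠ 0 := fun ξ hξ => ne_of_gt hξ
  have hq0 : ∀ ξ ∈ Ioi (0 : ℝ), 1 + r ξ ^ 2 ≠ 0 := fun ξ _ => by positivity
  have hw'c : ContinuousOn w' (Ioi 0) := by
    refine (continuousOn_phaseFactor a x).mul (ContinuousOn.sub ?_ (continuousOn_const.mul
      (Complex.continuous_ofReal.comp_continuousOn (continuousOn_slopeAmplitudeDeriv a x))))
    refine Complex.continuous_ofReal.comp_continuousOn ?_
    exact (((hrc.pow 2).div ((hrc.pow 2).const_add 1) hq0)).div hidc hne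
  set H : ℝ → ℂ := fun ξ => ξ * f ξ with hH
  have hHc : ContinuousOn H (Ioi 0) :=
    (Complex.continuous_ofReal.comp_continuousOn hidc).mul h.continuousOn
  have hgi := h.intervalIntegrable α β hα0 hαβ
  have ibp := integral_deriv_mul_of_primitive hαβ hderiv
    (hw'c.intervalIntegrable_of_pos hα0 hαβ) hgi (H := H) fun ξ hξ => h.mul_eq α ξ hα0 hξ.1
  have hHle : ∀ ξ ∈ Icc α β, ‖H ξ‖ ≤ P * N * ξ ^ (a / 2) := by
    intro ξ hξ
    have hξ0 := hpos ξ hξ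
    rw [hH, norm_mul, Complex.norm_real, Real.norm_eq_abs, abs_of_pos hξ0]
    exact h.norm_le ha hN hA hE hξ0 (hAα.trans hξ.1)
  have hwn : ∀ ξ, ‖w ξ‖ = |slopeAmplitude a x ξ| := fun ξ => by
    rw [hw, norm_mul, norm_phaseFactor, norm_mul, norm_neg, Complex.norm_I, Complex.norm_real,
      one_mul, one_mul, Real.norm_eq_abs]
  have hwle : ∀ ξ ∈ Icc α β, ‖w ξ‖ = |r ξ| / (1 + r ξ ^ 2) * ξ ^ (-(a / 2)) := by
    intro ξ hξ
    have hξ0 := hpos ξ hξ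
    rw [hwn, slopeAmplitude, abs_mul, abs_div, abs_of_pos (show 0 < 1 + r ξ ^ 2 by positivity),
      abs_of_pos (show 0 < ξ ^ (-(a / 2)) by positivity)]
  have hbdry : ∀ ξ ∈ Icc α β, ‖w ξ * H ξ‖ ≤ P * N := by
    intro ξ hξ
    have hξ0 := hpos ξ hξ
    have hs : 0 < ξ ^ (a / 2) := by positivity
    have h1 : |r ξ| / (1 + r ξ ^ 2) ≤ 1 := by
      rw [div_le_one (by positivity), ← sq_abs]
      nlinarith [sq_nonneg (|r ξ| - 1)]
    have h2 : ‖w ξ‖ ≤ ξ ^ (-(a / 2)) := by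
      rw [hwle ξ hξ]
      exact mul_le_of_le_one_left (by positivity) h1
    rw [norm_mul]
    refine (mul_le_mul h2 (hHle ξ hξ) (norm_nonneg _) (by positivity)).trans (le_of_eq ?_)
    rw [Real.rpow_neg hξ0.le]
    field_simp
  have iJ : IntervalIntegrable (fun ξ => ξ ^ (a / 2) / ξ / (1 + r ξ ^ 2)) volume α β :=
    (continuousOn_slopeWeight a x).intervalIntegrable_of_pos hα0 hαβ
  have iK : IntervalIntegrable (fun ξ => |r ξ| / ξ / (1 + r ξ ^ 2)) volume α β :=
    (continuousOn_slopeRatio a x).intervalIntegrable_of_pos hα0 hαβ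
  have hwg : ‖∫ ξ in α..β, w ξ * g ξ‖ ≤ (CJ + 1) / 2 * N := by
    have ig := h.intervalIntegrable_right hα0.le hαβ
    have h1 := norm_integral_le_of_norm_le hαβ (μ := volume) (f := fun ξ => w ξ * g ξ)
      (g := fun ξ => N / 2 * (ξ ^ (a / 2) / ξ / (1 + r ξ ^ 2))
        + 1 / (2 * N) * (ξ ^ (1 - a) * ‖g ξ‖ ^ 2)) ?_ ((iJ.const_mul _).add (ig.const_mul _))
    · refine h1.trans ?_
      rw [integral_add (iJ.const_mul _) (ig.const_mul _), intervalIntegral.integral_const_mul,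
        intervalIntegral.integral_const_mul]
      have h2 := h.weighted_integral_le hA hE hAα hαβ
      have h3 : 0 ≤ ∫ ξ in α..β, ξ ^ (1 - a) * ‖f ξ‖ ^ 2 := integral_nonneg hαβ fun ξ hξ => by
        have := hpos ξ hξ
        positivity
      have h4 : 1 / (2 * N) * (∫ ξ in α..β, ξ ^ (1 - a) * ‖g ξ‖ ^ 2) ≤ 1 / (2 * N) * N ^ 2 := by
        gcongr; linarith
      have h5 : 1 / (2 * N) * N ^ 2 = N / 2 := by field_simp
      have h6 := mul_le_mul_of_nonneg_left hJ1 (half_pos hN).le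
      linarith
    · refine Filter.Eventually.of_forall fun ξ hξ => ?_
      have hξI : ξ ∈ Icc α β := ⟨hξ.1.le, hξ.2⟩
      have hξ0 := hpos ξ hξI
      have hξ1 : 1 ≤ ξ := hα.trans hξI.1
      have e : ξ ^ (1 - a) * (ξ ^ a / ξ) = 1 := by
        rw [mul_div_assoc', ← Real.rpow_add hξ0]; simp [hξ0.ne']
      rw [norm_mul]
      refine (mul_le_weighted_sq (y := ‖w ξ‖) (z := ‖g ξ‖) hN (by positivity) e).trans ?_
      -- `ξ ≥ 1` is used to insert the factor `ξ ^ (a / 2)`.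
      have h7 : ξ ^ a / ξ * ‖w ξ‖ ^ 2 ≤ ξ ^ (a / 2) / ξ / (1 + r ξ ^ 2) := by
        have e2 : ξ ^ a = ξ ^ (a / 2) * ξ ^ (a / 2) := by rw [← Real.rpow_add hξ0]; ring_nf
        have hs1 : 1 ≤ ξ ^ (a / 2) := Real.one_le_rpow hξ1 (by positivity)
        have hs : 0 < ξ ^ (a / 2) := by positivity
        have e3 : ξ ^ a / ξ * ‖w ξ‖ ^ 2 = (r ξ ^ 2 / (1 + r ξ ^ 2)) / ξ / (1 + r ξ ^ 2) := by
          rw [hwle ξ hξI, e2, Real.rpow_neg hξ0.le, ← sq_abs (r ξ)]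
          field_simp
        rw [e3]
        gcongr
        refine le_trans ?_ hs1
        rw [div_le_one (by positivity)]
        linarith
      have h8 := mul_le_mul_of_nonneg_right h7 hN.le
      have e4 : (ξ ^ a / ξ * ‖w ξ‖ ^ 2 * N + ξ ^ (1 - a) * ‖g ξ‖ ^ 2 / N) / 2
          = ξ ^ a / ξ * ‖w ξ‖ ^ 2 * N / 2 + 1 / (2 * N) * (ξ ^ (1 - a) * ‖g ξ‖ ^ 2) := by
        field_simp
      rw [e4]
      linarith
  have herr : ‖∫ ξ in α..β, (phaseFactor a x ξ / ξ - w' ξ) * H ξ‖ ≤ P * (d + b + 1) * CJ * N := by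
    have h1 := norm_integral_le_of_norm_le hαβ (μ := volume)
      (f := fun ξ => (phaseFactor a x ξ / ξ - w' ξ) * H ξ)
      (g := fun ξ => P * N * d * (|r ξ| / ξ / (1 + r ξ ^ 2))
        + P * N * (b + 1) * (ξ ^ (a / 2) / ξ / (1 + r ξ ^ 2))) ?_
      ((iK.const_mul _).add (iJ.const_mul _))
    · refine h1.trans ?_
      rw [integral_add (iK.const_mul _) (iJ.const_mul _), intervalIntegral.integral_const_mul,
        intervalIntegral.integral_const_mul]
      have h2 := mul_le_mul_of_nonneg_left hJ2 (show 0 ≤ P * N * d by positivity)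
      have h3 := mul_le_mul_of_nonneg_left hJ1 (show 0 ≤ P * N * (b + 1) by positivity)
      linarith
    · refine Filter.Eventually.of_forall fun ξ hξ => ?_
      have hξI : ξ ∈ Icc α β := ⟨hξ.1.le, hξ.2⟩
      have hξ0 := hpos ξ hξI
      have hs : 0 < ξ ^ (a / 2) := by positivity
      have hq : 0 < 1 + r ξ ^ 2 := by positivity
      have e1 : phaseFactor a x ξ / ξ - w' ξ = phaseFactor a x ξ *
          (((1 / (1 + r ξ ^ 2) / ξ : ℝ) : ℂ) + Complex.I * (slopeAmplitudeDeriv a x ξ : ℂ)) := by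
        have e2 : (1 / (1 + r ξ ^ 2) / ξ : ℝ) = 1 / ξ - r ξ ^ 2 / (1 + r ξ ^ 2) / ξ := by
          field_simp
          ring
        rw [e2, hw']
        push_cast
        ring
      have h2 : ‖phaseFactor a x ξ / ξ - w' ξ‖
          ≤ 1 / (1 + r ξ ^ 2) / ξ + (d * |r ξ| + b * ξ ^ (a / 2)) * ξ ^ (-(a / 2)) / ξ
            / (1 + r ξ ^ 2) := by
        rw [e1, norm_mul, norm_phaseFactor, one_mul]
        refine (norm_add_le _ _).trans (add_le_add (le_of_eq ?_) ?_)
        · rw [Complex.norm_real, Real.norm_eq_abs, abs_of_pos (by positivity)]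
        · rw [norm_mul, Complex.norm_I, one_mul, Complex.norm_real, Real.norm_eq_abs]
          exact abs_slopeAmplitudeDeriv_le ha x hξ0
      rw [norm_mul]
      refine (mul_le_mul h2 (hHle ξ hξI) (norm_nonneg _) ?_).trans (le_of_eq ?_)
      · positivity
      · rw [Real.rpow_neg hξ0.le]
        field_simp
        ring
  have hosc : IntervalIntegrable (fun ξ => (phaseFactor a x ξ / ξ - w' ξ) * H ξ) volume α β := by
    refine ContinuousOn.intervalIntegrable_of_pos (ContinuousOn.mul (ContinuousOn.sub
      ((continuousOn_phaseFactor a x).div (Complex.continuous_ofReal.comp_continuousOn hidc)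
        fun ξ hξ => ?_) hw'c) hHc) hα0 hαβ
    exact Complex.ofReal_ne_zero.2 (hne ξ hξ)
  have hsplit : ∫ ξ in α..β, phaseFactor a x ξ * f ξ
      = (∫ ξ in α..β, w' ξ * H ξ) + ∫ ξ in α..β, (phaseFactor a x ξ / ξ - w' ξ) * H ξ := by
    have hw'H : ContinuousOn (fun ξ => w' ξ * H ξ) (Ioi 0) := hw'c.mul hHc
    rw [← integral_add (hw'H.intervalIntegrable_of_pos hα0 hαβ) hosc]
    refine integral_congr fun ξ hξ => ?_
    rw [uIcc_of_le hαβ] at hξ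
    have : (ξ : ℂ) ≠ 0 := by exact_mod_cast (hpos ξ hξ).ne'
    simp only [hH]
    field_simp
    ring
  rw [hsplit, ibp]
  have hb1 := hbdry β ⟨hαβ, le_rfl⟩
  have hb2 := hbdry α ⟨le_rfl, hαβ⟩
  calc _ ≤ ‖w β * H β‖ + ‖w α * H α‖ + ‖∫ ξ in α..β, w ξ * g ξ‖
        + ‖∫ ξ in α..β, (phaseFactor a x ξ / ξ - w' ξ) * H ξ‖ :=
        (norm_add_le _ _).trans (add_le_add_left ((norm_sub_le _ _).trans
          (add_le_add_left (norm_sub_le _ _) _)) _)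
    _ ≤ _ := by linarith

/-- Below frequency `1` the pointwise bound is integrable, and no oscillation is needed. -/
theorem IsHalfLineProfile.integral_norm_low_le {a : ℝ} (ha : 0 < a) {f g : ℝ → ℂ}
    (h : IsHalfLineProfile a f g) {N A α β : ℝ} (hN : 0 < N) (hA : 0 ≤ A)
    (hE : tailEnergy a f g A ≤ N ^ 2) (hAα : A ≤ α) (hα : 0 < α) (hαβ : α ≤ β) (hβ : β ≤ 1) :
    ∫ ξ in α..β, ‖f ξ‖ ≤ (1 + 2 * ((2 ^ a - 1) / a)) * (2 / a) * N := by
  set P := 1 + 2 * (((2 : ℝ) ^ a - 1) / a) with hP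
  have hP0 : 0 < P := one_add_two_rpow_sub_one_div_pos ha
  have hp : IntervalIntegrable (fun η : ℝ => η ^ (a / 2) / η) volume α β :=
    ContinuousOn.intervalIntegrable_of_pos ((continuousOn_rpow_Ioi _).div continuousOn_id
      fun ξ hξ => (ne_of_gt hξ)) hα hαβ
  have h1 := integral_mono_on hαβ (h.continuousOn.intervalIntegrable_of_pos hα hαβ).norm
    (hp.const_mul (P * N)) fun ξ hξ => by
      have hξ0 : 0 < ξ := hα.trans_le hξ.1
      rw [mul_div_assoc', le_div_iff₀ hξ0, mul_comm]
      exact h.norm_le ha hN hA hE hξ0 (hAα.trans hξ.1)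
  refine h1.trans ?_
  rw [intervalIntegral.integral_const_mul, integral_rpow_div_eq (half_pos ha) hα hαβ]
  have h2 : β ^ (a / 2) ≤ 1 := Real.rpow_le_one (hα.trans_le hαβ).le hβ (half_pos ha).le
  have h3 : 0 ≤ α ^ (a / 2) := by positivity
  calc P * N * ((β ^ (a / 2) - α ^ (a / 2)) / (a / 2)) ≤ P * N * (1 / (a / 2)) := by
        gcongr; linarith
    _ = _ := by field_simp

/-- The oscillatory estimate on a half-line, uniform in `x`. The bound involves only the energy above
`A`, so that it also controls the convergence of the improper integral. -/
theorem exists_norm_integral_phaseFactor_le {a : ℝ} (ha : 0 < a) (ha1 : a ≠ 1) :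
    ∃ C : ℝ, 0 < C ∧ ∀ f g : ℝ → ℂ, IsHalfLineProfile a f g → ∀ N A : ℝ, 0 < N → 0 ≤ A →
      tailEnergy a f g A ≤ N ^ 2 → ∀ x α β : ℝ, A ≤ α → 0 < α → α ≤ β →
        ‖∫ ξ in α..β, phaseFactor a x ξ * f ξ‖ ≤ C * N := by
  obtain ⟨C, hC, hhigh⟩ := exists_norm_integral_high_le ha ha1
  set Q := (1 + 2 * (((2 : ℝ) ^ a - 1) / a)) * (2 / a) with hQ
  have hQ0 : 0 < Q := mul_pos (one_add_two_rpow_sub_one_div_pos ha) (by positivity)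
  refine ⟨C + Q, by positivity, fun f g h N A hN hA hE x α β hAα hα hαβ => ?_⟩
  have hCN : 0 < C * N := by positivity
  have hQN : 0 < Q * N := by positivity
  have hlow : ∀ β', α ≤ β' → β' ≤ 1 → ‖∫ ξ in α..β', phaseFactor a x ξ * f ξ‖ ≤ Q * N := by
    intro β' h1 h2
    refine (intervalIntegral.norm_integral_le_integral_norm h1).trans ?_
    simp only [norm_mul, norm_phaseFactor, one_mul]
    exact h.integral_norm_low_le ha hN hA hE hAα hα h1 h2
  rcases le_total 1 α with h1 | h1
  · have := hhigh f g h N A hN hA hE x α β hAα h1 hαβ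
    linarith
  rcases le_total β 1 with h2 | h2
  · have := hlow β hαβ h2
    linarith
  have hc : ContinuousOn (fun ξ => phaseFactor a x ξ * f ξ) (Ioi 0) :=
    (continuousOn_phaseFactor a x).mul h.continuousOn
  rw [← integral_add_adjacent_intervals (hc.intervalIntegrable_of_pos hα h1)
    (hc.intervalIntegrable_of_pos one_pos h2)]
  refine (norm_add_le _ _).trans ?_
  have h3 := hhigh f g h N A hN hA hE x 1 β (hAα.trans h1) le_rfl h2
  have h4 := hlow 1 h1 le_rfl
  linarith

end

/-! ### Scaling in time -/

section

open Set intervalIntegral Filter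
open scoped Topology

theorem rpow_comp_div_eq {l η s c : ℝ} (hl : 0 < l) (hη : 0 < η) :
    η ^ s * c = l ^ s * ((η / l) ^ s * c) := by
  rw [Real.div_rpow hη.le hl.le]
  field_simp

theorem integrableOn_weight_comp_div {s l : ℝ} (hl : 0 < l) {u : ℝ → ℂ}
    (hu : IntegrableOn (fun ξ : ℝ => ξ ^ s * ‖u ξ‖ ^ 2) (Ioi 0)) :
    IntegrableOn (fun ξ : ℝ => ξ ^ s * ‖u (ξ / l)‖ ^ 2) (Ioi 0) := by
  have h1 : IntegrableOn (fun ξ : ℝ => l ^ s * ((ξ / l) ^ s * ‖u (ξ / l)‖ ^ 2)) (Ioi 0) := by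
    refine Integrable.const_mul ?_ _
    have := (integrableOn_Ioi_comp_mul_right_iff (fun ξ : ℝ => ξ ^ s * ‖u ξ‖ ^ 2) 0
      (inv_pos.2 hl)).2 (by simpa using hu)
    simpa only [div_eq_mul_inv] using! this
  exact h1.congr_fun (fun η hη => (rpow_comp_div_eq hl hη).symm) measurableSet_Ioi

theorem setIntegral_weight_comp_div {s l A : ℝ} (hl : 0 < l) (hA : 0 ≤ A) (u : ℝ → ℂ) :
    ∫ ξ in Ioi (l * A), ξ ^ s * ‖u (ξ / l)‖ ^ 2
      = l ^ (s + 1) * ∫ ξ in Ioi A, ξ ^ s * ‖u ξ‖ ^ 2 := by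
  have h1 : ∫ ξ in Ioi (l * A), ξ ^ s * ‖u (ξ / l)‖ ^ 2
      = ∫ ξ in Ioi (l * A), l ^ s * ((ξ * l⁻¹) ^ s * ‖u (ξ * l⁻¹)‖ ^ 2) :=
    setIntegral_congr_fun measurableSet_Ioi fun η hη => by
      have hη0 : 0 < η := (by positivity : 0 ≤ l * A).trans_lt hη
      simp only [← div_eq_mul_inv]
      exact rpow_comp_div_eq hl hη0
  rw [h1, MeasureTheory.integral_const_mul,
    integral_comp_mul_right_Ioi (fun ξ : ℝ => ξ ^ s * ‖u ξ‖ ^ 2) _ (inv_pos.2 hl),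
    show l * A * l⁻¹ = A by field_simp, inv_inv, smul_eq_mul, ← mul_assoc, Real.rpow_add_one hl.ne']

theorem IsHalfLineProfile.comp_div {a l : ℝ} (hl : 0 < l) {f g : ℝ → ℂ}
    (h : IsHalfLineProfile a f g) :
    IsHalfLineProfile a (fun ξ => f (ξ / l)) (fun ξ => g (ξ / l)) where
  intervalIntegrable A B hA hAB := by
    have := (h.intervalIntegrable (A / l) (B / l) (by positivity) (by gcongr)).comp_mul_right
      (c := l⁻¹)
    simpa [div_eq_mul_inv, hl.ne'] using this
  mul_eq A B hA hAB := by
    have h1 := h.mul_eq (A / l) (B / l) (by positivity) (by gcongr)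
    have h2 : ∫ ξ in A..B, g (ξ / l) = l * ∫ ξ in (A / l)..(B / l), g ξ := by
      rw [integral_comp_div _ hl.ne', Complex.real_smul]
    have hl' : (l : ℂ) ≠ 0 := by exact_mod_cast hl.ne'
    rw [h2]
    push_cast at h1
    field_simp at h1
    linear_combination h1
  integrableOn_left := integrableOn_weight_comp_div hl h.integrableOn_left
  integrableOn_right := integrableOn_weight_comp_div hl h.integrableOn_right

theorem tailEnergy_comp_div {a l A : ℝ} (hl : 0 < l) (hA : 0 ≤ A) (f g : ℝ → ℂ) :
    tailEnergy a (fun ξ => f (ξ / l)) (fun ξ => g (ξ / l)) (l * A)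
      = l ^ (2 - a) * tailEnergy a f g A := by
  rw [tailEnergy, tailEnergy, setIntegral_weight_comp_div hl hA, setIntegral_weight_comp_div hl hA,
    show 1 - a + 1 = 2 - a by ring]
  ring

/-- The kernel `e^{2 π i x ξ} e^{i t |2 π ξ|^a}` of the flow. -/
noncomputable def flowKernel (a t x ξ : ℝ) : ℂ :=
  Complex.exp (Complex.I * ((2 * Real.pi * x * ξ + t * |2 * Real.pi * ξ| ^ a : ℝ) : ℂ))

theorem norm_flowKernel (a t x ξ : ℝ) : ‖flowKernel a t x ξ‖ = 1 := by
  rw [flowKernel, mul_comm, Complex.norm_exp_ofReal_mul_I]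

theorem flowKernel_neg (a t x ξ : ℝ) : flowKernel a t x (-ξ) = flowKernel a t (-x) ξ := by
  rw [flowKernel, flowKernel, mul_neg (2 * Real.pi) ξ, abs_neg]
  ring_nf

theorem measurable_flowKernel (a t x : ℝ) : Measurable (flowKernel a t x) := by
  unfold flowKernel
  fun_prop

theorem flowKernel_eq_phaseFactor {a t : ℝ} (ha : a ≠ 0) (ht : 0 < t) (x : ℝ) {ξ : ℝ} (hξ : 0 ≤ ξ) :
    flowKernel a t x ξ = phaseFactor a (2 * Real.pi * x / (2 * Real.pi * t ^ (1 / a)))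
      (2 * Real.pi * t ^ (1 / a) * ξ) := by
  have hpi := Real.pi_pos
  have h1 : t * |2 * Real.pi * ξ| ^ a = (2 * Real.pi * t ^ (1 / a) * ξ) ^ a := by
    rw [abs_of_nonneg (by positivity), show 2 * Real.pi * t ^ (1 / a) * ξ
      = t ^ (1 / a) * (2 * Real.pi * ξ) by ring,
      Real.mul_rpow (x := t ^ (1 / a)) (by positivity) (by positivity),
      ← Real.rpow_mul ht.le, one_div_mul_cancel ha, Real.rpow_one]
  have h2 : 2 * Real.pi * x / (2 * Real.pi * t ^ (1 / a)) * (2 * Real.pi * t ^ (1 / a) * ξ)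
      = 2 * Real.pi * x * ξ := by
    have : 0 < t ^ (1 / a) := by positivity
    field_simp
  rw [flowKernel, phaseFactor, h1, h2]

/-- The oscillatory estimate for the kernel of the flow. The dilation by `2 π t ^ (1 / a)` reduces it
to `t = 1` and produces the factor `t ^ (-1 / 2)`. -/
theorem exists_norm_integral_flowKernel_le {a : ℝ} (ha : 0 < a) (ha1 : a ≠ 1) :
    ∃ C : ℝ, 0 < C ∧ ∀ f g : ℝ → ℂ, IsHalfLineProfile a f g →
      (∀ β : ℝ, IntervalIntegrable f volume 0 β) → ∀ N A : ℝ, 0 < N → 0 ≤ A →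
      tailEnergy a f g A ≤ N ^ 2 → ∀ t x α β : ℝ, 0 < t → A ≤ α → α ≤ β →
        ‖∫ ξ in α..β, flowKernel a t x ξ * f ξ‖ ≤ C * t ^ (-(1 / 2) : ℝ) * N := by
  obtain ⟨C, hC, hosc⟩ := exists_norm_integral_phaseFactor_le ha ha1
  have hpi : (0 : ℝ) < 2 * Real.pi := by positivity
  refine ⟨C * (2 * Real.pi) ^ (-(a / 2)), by positivity, ?_⟩
  intro f g h hf N A hN hA hE t x α β ht hAα hαβ
  have hpos : ∀ α, A ≤ α → 0 < α → α ≤ β → ‖∫ ξ in α..β, flowKernel a t x ξ * f ξ‖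
      ≤ C * (2 * Real.pi) ^ (-(a / 2)) * t ^ (-(1 / 2) : ℝ) * N := by
    intro α hAα hα hαβ
    set l := 2 * Real.pi * t ^ (1 / a) with hl
    have hl0 : 0 < l := by positivity
    have h1 : ∫ ξ in α..β, flowKernel a t x ξ * f ξ
        = l⁻¹ • ∫ η in (l * α)..(l * β), phaseFactor a (2 * Real.pi * x / l) η * f (η / l) := by
      rw [← integral_comp_mul_left (fun η => phaseFactor a (2 * Real.pi * x / l) η * f (η / l))
        hl0.ne']
      refine integral_congr fun ξ hξ => ?_
      rw [uIcc_of_le hαβ] at hξ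
      rw [flowKernel_eq_phaseFactor ha.ne' ht x (hα.le.trans hξ.1), ← hl,
        mul_div_cancel_left₀ _ hl0.ne']
    have hE' : tailEnergy a (fun ξ => f (ξ / l)) (fun ξ => g (ξ / l)) (l * A)
        ≤ (l ^ (1 - a / 2) * N) ^ 2 := by
      have e : (l ^ (1 - a / 2)) ^ 2 = l ^ (2 - a) := by
        rw [← Real.rpow_natCast, ← Real.rpow_mul hl0.le]; congr 1; push_cast; ring
      rw [tailEnergy_comp_div hl0 hA, mul_pow, e]
      gcongr
    have h2 := hosc _ _ (h.comp_div hl0) (l ^ (1 - a / 2) * N) (l * A) (by positivity)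
      (by positivity) hE' (2 * Real.pi * x / l) (l * α) (l * β) (by gcongr) (by positivity)
      (by gcongr)
    rw [h1, norm_smul, norm_inv, Real.norm_eq_abs, abs_of_pos hl0]
    refine (mul_le_mul_of_nonneg_left h2 (inv_nonneg.2 hl0.le)).trans (le_of_eq ?_)
    have e1 : l⁻¹ * l ^ (1 - a / 2) = l ^ (-(a / 2)) := by
      rw [← Real.rpow_neg_one, ← Real.rpow_add hl0]; ring_nf
    have e2 : l ^ (-(a / 2)) = (2 * Real.pi) ^ (-(a / 2)) * t ^ (-(1 / 2) : ℝ) := by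
      rw [hl, Real.mul_rpow hpi.le (by positivity), ← Real.rpow_mul ht.le]
      congr 2
      field_simp
    calc l⁻¹ * (C * (l ^ (1 - a / 2) * N)) = C * (l⁻¹ * l ^ (1 - a / 2)) * N := by ring
      _ = _ := by rw [e1, e2]; ring
  -- The lower end point `α = 0` is reached by letting `α` decrease to `0`.
  rcases (hA.trans hAα).eq_or_lt with h0 | h0
  · subst h0
    rcases hαβ.eq_or_lt with hβ | hβ
    · subst hβ
      simp only [integral_same, norm_zero]
      positivity
    have hi : IntervalIntegrable (fun ξ => flowKernel a t x ξ * f ξ) volume 0 β := by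
      have hb : ∀ μ : Measure ℝ, ∀ᵐ ξ ∂μ, ‖flowKernel a t x ξ‖ ≤ 1 := fun μ =>
        Eventually.of_forall fun ξ => (norm_flowKernel a t x ξ).le
      exact ⟨(hf β).1.bdd_mul (measurable_flowKernel a t x).aestronglyMeasurable (hb _),
        (hf β).2.bdd_mul (measurable_flowKernel a t x).aestronglyMeasurable (hb _)⟩
    have hc := continuousWithinAt_primitive (μ := volume) (a := β) (b₀ := 0) (b₁ := 0) (b₂ := β)
      (by simp) (f := fun ξ => flowKernel a t x ξ * f ξ) (by
        rw [min_eq_right hβ.le, max_self]; exact hi)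
    have hc' : Tendsto (fun α => ‖∫ ξ in α..β, flowKernel a t x ξ * f ξ‖) (𝓝[>] 0)
        (𝓝 ‖∫ ξ in (0:ℝ)..β, flowKernel a t x ξ * f ξ‖) := by
      have h3 : Tendsto (fun b => ∫ ξ in β..b, flowKernel a t x ξ * f ξ) (𝓝[Icc 0 β] 0)
        (𝓝 (∫ ξ in β..0, flowKernel a t x ξ * f ξ)) := hc
      have h4 := (h3.mono_left (nhdsWithin_mono 0 Ioc_subset_Icc_self)).norm
      rw [nhdsWithin_Ioc_eq_nhdsGT hβ] at h4
      simpa only [integral_symm _ β, norm_neg] using h4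
    refine le_of_tendsto hc' ?_
    filter_upwards [Ioc_mem_nhdsGT hβ] with α hα
    exact hpos α (hAα.trans hα.1.le) hα.1 hα.2
  · exact hpos α hAα h0 hαβ

end

/-! ### Convergence of the truncated flow -/

section

open Set intervalIntegral Filter
open scoped Topology

theorem tendsto_setIntegral_Ioi_nat {u : ℝ → ℝ} (hu : IntegrableOn u (Ioi 0)) :
    Tendsto (fun n : ℕ => ∫ ξ in Ioi (n : ℝ), u ξ) atTop (𝓝 0) := by
  have h := tendsto_setIntegral_of_antitone (μ := volume) (f := u)
    (s := fun n : ℕ => Ioi (n : ℝ)) (fun _ => measurableSet_Ioi)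
    (fun m n hmn => Ioi_subset_Ioi (by exact_mod_cast hmn)) ⟨0, by simpa using hu⟩
  have he : (⋂ n : ℕ, Ioi (n : ℝ)) = ∅ := by
    ext x
    obtain ⟨n, hn⟩ := exists_nat_gt x
    simp only [mem_iInter, mem_Ioi, mem_empty_iff_false, iff_false, not_forall, not_lt]
    exact ⟨n, hn.le⟩
  simpa [he] using h

theorem IsHalfLineProfile.tendsto_tailEnergy {a : ℝ} {f g : ℝ → ℂ} (h : IsHalfLineProfile a f g) :
    Tendsto (fun n : ℕ => tailEnergy a f g n) atTop (𝓝 0) := by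
  simpa [tailEnergy] using (tendsto_setIntegral_Ioi_nat h.integrableOn_left).add
    (tendsto_setIntegral_Ioi_nat h.integrableOn_right)

/-- The inverse Fourier integral of `e ^ (i t |2 π ξ| ^ a) F(ξ)` over `|ξ| ≤ R`, evaluated at `x`. -/
noncomputable def truncatedFlow (a t : ℝ) (F : ℝ → ℂ) (R x : ℝ) : ℂ :=
  ∫ ξ in (-R)..R, flowKernel a t x ξ * F ξ

theorem intervalIntegrable_flowKernel_mul {a t x : ℝ} {F : ℝ → ℂ} (hF : LocallyIntegrable F volume)
    (α β : ℝ) : IntervalIntegrable (fun ξ => flowKernel a t x ξ * F ξ) volume α β := by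
  have hb : ∀ μ : Measure ℝ, ∀ᵐ ξ ∂μ, ‖flowKernel a t x ξ‖ ≤ 1 := fun μ =>
    Eventually.of_forall fun ξ => (norm_flowKernel a t x ξ).le
  have hi : IntervalIntegrable F volume α β :=
    (hF.integrableOn_isCompact isCompact_uIcc).intervalIntegrable
  exact ⟨hi.1.bdd_mul (measurable_flowKernel a t x).aestronglyMeasurable (hb _),
    hi.2.bdd_mul (measurable_flowKernel a t x).aestronglyMeasurable (hb _)⟩

/-- The frequencies `α ≤ |ξ| ≤ β` split into two half-lines; reflecting the negative one replaces `x`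
by `-x`. -/
theorem truncatedFlow_sub {a t x : ℝ} {F : ℝ → ℂ} (hF : LocallyIntegrable F volume)
    (α β : ℝ) : truncatedFlow a t F β x - truncatedFlow a t F α x
      = (∫ ξ in α..β, flowKernel a t x ξ * F ξ)
        + ∫ ξ in α..β, flowKernel a t (-x) ξ * F (-ξ) := by
  have hi := intervalIntegrable_flowKernel_mul (a := a) (t := t) (x := x) hF
  have h1 : ∫ ξ in α..β, flowKernel a t (-x) ξ * F (-ξ)
      = ∫ ξ in (-β)..(-α), flowKernel a t x ξ * F ξ := by
    rw [← integral_comp_neg]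
    simp only [flowKernel_neg]
  rw [h1, truncatedFlow, truncatedFlow,
    ← integral_add_adjacent_intervals (hi (-β) (-α)) (hi (-α) β),
    ← integral_add_adjacent_intervals (hi (-α) α) (hi α β)]
  ring

theorem truncatedFlow_eq_fourierInv (a t : ℝ) (F : ℝ → ℂ) {R : ℝ} (hR : 0 ≤ R) (x : ℝ) :
    truncatedFlow a t F R x = 𝓕⁻ ((Ioc (-R) R).indicator fun ξ : ℝ =>
      Complex.exp (Complex.I * ((t * |2 * Real.pi * ξ| ^ a : ℝ) : ℂ)) * F ξ) x := by
  rw [Real.fourierInv_eq', truncatedFlow, integral_of_le (by linarith),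
    ← MeasureTheory.integral_indicator measurableSet_Ioc]
  congr 1
  ext ξ
  by_cases hξ : ξ ∈ Ioc (-R) R
  · rw [indicator_of_mem hξ, indicator_of_mem hξ, flowKernel, smul_eq_mul, ← mul_assoc,
      ← Complex.exp_add]
    congr 2
    have : inner ℝ ξ x = x * ξ := by simp
    rw [this]
    push_cast
    ring
  · rw [indicator_of_notMem hξ, indicator_of_notMem hξ, smul_zero]

theorem integrable_indicator_flow {F : ℝ → ℂ} (hF : LocallyIntegrable F volume) (a t R : ℝ) :
    Integrable ((Ioc (-R) R).indicator fun ξ : ℝ =>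
      Complex.exp (Complex.I * ((t * |2 * Real.pi * ξ| ^ a : ℝ) : ℂ)) * F ξ) := by
  rw [integrable_indicator_iff measurableSet_Ioc]
  have hi : IntegrableOn F (Ioc (-R) R) :=
    (hF.integrableOn_isCompact isCompact_Icc).mono_set Ioc_subset_Icc_self
  refine hi.bdd_mul (c := 1) (Measurable.aestronglyMeasurable (by fun_prop))
    (Eventually.of_forall fun ξ => ?_)
  rw [mul_comm, Complex.norm_exp_ofReal_mul_I]

theorem continuous_truncatedFlow {F : ℝ → ℂ} (hF : LocallyIntegrable F volume) (a t : ℝ) {R : ℝ}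
    (hR : 0 ≤ R) : Continuous (truncatedFlow a t F R) := by
  have h1 := VectorFourier.fourierIntegral_continuous Real.continuous_fourierChar
    (L := innerₗ ℝ) (by exact continuous_inner) (integrable_indicator_flow hF a t R)
  have h2 : truncatedFlow a t F R = fun x => 𝓕 ((Ioc (-R) R).indicator fun ξ : ℝ =>
      Complex.exp (Complex.I * ((t * |2 * Real.pi * ξ| ^ a : ℝ) : ℂ)) * F ξ) (-x) := by
    ext x
    rw [truncatedFlow_eq_fourierInv a t F hR, Real.fourierInv_eq_fourier_neg]
  rw [h2]
  exact h1.comp continuous_neg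

/-- The truncated flows converge uniformly in `x`, since the energy of the tails tends to zero; the
limit is continuous and satisfies the dispersive bound. -/
theorem exists_flow_limit {a : ℝ} (ha : 0 < a) (ha1 : a ≠ 1) :
    ∃ C : ℝ, 0 < C ∧ ∀ F h : ℝ → ℂ, LocallyIntegrable F volume → IsHalfLineProfile a F h →
      IsHalfLineProfile a (fun ξ => F (-ξ)) (fun ξ => h (-ξ)) → ∀ t : ℝ, 0 < t →
      ∃ u : ℝ → ℂ, Continuous u ∧
        (∃ M : ℝ, ∀ (n : ℕ) (x : ℝ), ‖truncatedFlow a t F n x‖ ≤ M) ∧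
        (∀ x, Tendsto (fun n : ℕ => truncatedFlow a t F n x) atTop (𝓝 (u x))) ∧
        ∀ N : ℝ, 0 < N → tailEnergy a F h 0 ≤ N ^ 2 →
          tailEnergy a (fun ξ => F (-ξ)) (fun ξ => h (-ξ)) 0 ≤ N ^ 2 →
          ∀ x, ‖u x‖ ≤ C * t ^ (-(1 / 2) : ℝ) * N := by
  obtain ⟨C, hC, hb⟩ := exists_norm_integral_flowKernel_le ha ha1
  refine ⟨2 * C, by positivity, fun F h hF hp hm t ht => ?_⟩
  have hFi : ∀ β : ℝ, IntervalIntegrable F volume 0 β := fun β =>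
    (hF.integrableOn_isCompact isCompact_uIcc).intervalIntegrable
  have hFm : ∀ β : ℝ, IntervalIntegrable (fun ξ => F (-ξ)) volume 0 β := fun β => by
    have : IntervalIntegrable F volume (-0) (-β) :=
      (hF.integrableOn_isCompact isCompact_uIcc).intervalIntegrable
    simpa using this.comp_sub_left 0
  have key : ∀ N A : ℝ, 0 < N → 0 ≤ A → tailEnergy a F h A ≤ N ^ 2 →
      tailEnergy a (fun ξ => F (-ξ)) (fun ξ => h (-ξ)) A ≤ N ^ 2 → ∀ x α β : ℝ, A ≤ α → α ≤ β →
      ‖truncatedFlow a t F β x - truncatedFlow a t F α x‖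
        ≤ 2 * C * t ^ (-(1 / 2) : ℝ) * N := by
    intro N A hN hA h1 h2 x α β hα hαβ
    rw [truncatedFlow_sub hF]
    have e1 := hb _ _ hp hFi N A hN hA h1 t x α β ht hα hαβ
    have e2 := hb _ _ hm hFm N A hN hA h2 t (-x) α β ht hα hαβ
    refine (norm_add_le _ _).trans ?_
    linarith
  have hzero : ∀ x, truncatedFlow a t F 0 x = 0 := fun x => by simp [truncatedFlow]
  have hbound : ∀ N : ℝ, 0 < N → tailEnergy a F h 0 ≤ N ^ 2 →
      tailEnergy a (fun ξ => F (-ξ)) (fun ξ => h (-ξ)) 0 ≤ N ^ 2 →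
      ∀ (n : ℕ) (x : ℝ), ‖truncatedFlow a t F n x‖ ≤ 2 * C * t ^ (-(1 / 2) : ℝ) * N := by
    intro N hN h1 h2 n x
    simpa [hzero] using key N 0 hN le_rfl h1 h2 x 0 n le_rfl n.cast_nonneg
  have ht0 : 0 < t ^ (-(1 / 2) : ℝ) := by positivity
  have hcauchy : UniformCauchySeqOn (fun (n : ℕ) x => truncatedFlow a t F n x) atTop univ := by
    rw [Metric.uniformCauchySeqOn_iff]
    intro ε hε
    -- An energy bound `N ^ 2` of the tails for which the oscillatory estimate yields `ε / 2`.
    set N := ε / (2 * (2 * C * t ^ (-(1 / 2) : ℝ))) with hN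
    have hN0 : 0 < N := by positivity
    have hN2 : 2 * C * t ^ (-(1 / 2) : ℝ) * N = ε / 2 := by rw [hN]; field_simp
    have e1 := hp.tendsto_tailEnergy.eventually (eventually_le_nhds (show 0 < N ^ 2 by positivity))
    have e2 := hm.tendsto_tailEnergy.eventually (eventually_le_nhds (show 0 < N ^ 2 by positivity))
    obtain ⟨n₀, h1, h2⟩ := (e1.and e2).exists
    have hlt : ∀ m n : ℕ, n₀ ≤ m → m ≤ n → ∀ x,
        ‖truncatedFlow a t F n x - truncatedFlow a t F m x‖ < ε := by
      intro m n hm hmn x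
      have := key N n₀ hN0 n₀.cast_nonneg h1 h2 x m n (by exact_mod_cast hm) (by exact_mod_cast hmn)
      linarith
    refine ⟨n₀, fun m hm n hn x _ => ?_⟩
    rcases le_total m n with hmn | hmn
    · rw [dist_comm, dist_eq_norm]; exact hlt m n hm hmn x
    · rw [dist_eq_norm]; exact hlt n m hn hmn x
  have hlim : ∀ x, ∃ z, Tendsto (fun n : ℕ => truncatedFlow a t F n x) atTop (𝓝 z) := fun x =>
    cauchySeq_tendsto_of_complete (hcauchy.cauchySeq (mem_univ x))
  choose u hu using hlim
  refine ⟨u, ?_, ?_, hu, fun N hN h1 h2 x => ?_⟩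
  · have hunif := hcauchy.tendstoUniformlyOn_of_tendsto fun x _ => hu x
    rw [tendstoUniformlyOn_univ] at hunif
    exact hunif.continuous (Frequently.of_forall fun n =>
      continuous_truncatedFlow hF a t n.cast_nonneg)
  · set E := tailEnergy a F h 0 with hE
    set E' := tailEnergy a (fun ξ => F (-ξ)) (fun ξ => h (-ξ)) 0 with hE'
    refine ⟨_, hbound (1 + |E| + |E'|) (by positivity) ?_ ?_⟩
    · nlinarith [le_abs_self E, abs_nonneg E, abs_nonneg E']
    · nlinarith [le_abs_self E', abs_nonneg E, abs_nonneg E']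
  · exact le_of_tendsto (hu x).norm (Eventually.of_forall fun n => hbound N hN h1 h2 n x)

theorem integral_fourier_mul_truncatedFlow {F : ℝ → ℂ} (hF : LocallyIntegrable F volume) (a t : ℝ)
    {R : ℝ} (hR : 0 ≤ R) (φ : 𝓢(ℝ, ℂ)) :
    ∫ x, (𝓕 φ) x * truncatedFlow a t F R x = ∫ ξ, φ ξ * (Ioc (-R) R).indicator (fun ξ : ℝ =>
      Complex.exp (Complex.I * ((t * |2 * Real.pi * ξ| ^ a : ℝ) : ℂ)) * F ξ) ξ := by
  set q := (Ioc (-R) R).indicator (fun ξ : ℝ =>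
      Complex.exp (Complex.I * ((t * |2 * Real.pi * ξ| ^ a : ℝ) : ℂ)) * F ξ) with hq
  have hqi : Integrable q := integrable_indicator_flow hF a t R
  have h1 := VectorFourier.integral_fourierIntegral_smul_eq_flip (μ := volume) (ν := volume)
    (L := innerₗ ℝ) (f := fun ξ : ℝ => q (-ξ)) (g := fun x => (𝓕 φ) x)
    Real.continuous_fourierChar (by exact continuous_inner) hqi.comp_neg (𝓕 φ).integrable
  have h2 : ∀ x, truncatedFlow a t F R x
      = VectorFourier.fourierIntegral Real.fourierChar volume (innerₗ ℝ) (fun ξ : ℝ => q (-ξ)) x := by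
    intro x
    rw [truncatedFlow_eq_fourierInv a t F hR, Real.fourierInv_eq_fourier_comp_neg]
    rfl
  have h3 : ∀ ξ : ℝ, VectorFourier.fourierIntegral Real.fourierChar volume (innerₗ ℝ).flip
      (fun x => (𝓕 φ) x) ξ = φ (-ξ) := by
    intro ξ
    rw [flip_innerₗ]
    have h4 : 𝓕⁻ (𝓕 φ) = φ := FourierTransform.fourierInv_fourier_eq φ
    have h5 := Real.fourierInv_eq_fourier_neg (fun x => (𝓕 φ) x) (-ξ)
    rw [neg_neg] at h5
    refine h5.symm.trans ?_
    rw [← SchwartzMap.fourierInv_coe, h4]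
  simp only [h3, ← h2, smul_eq_mul] at h1
  have h6 : ∫ ξ, q (-ξ) * φ (-ξ) = ∫ ξ, q ξ * φ ξ := integral_neg_eq_self (fun ξ => q ξ * φ ξ) _
  rw [h6] at h1
  simpa only [mul_comm] using h1

/-- A bounded limit of the truncated flows of the density of `u₀` represents the distribution
`e ^ (i t |D| ^ a) u₀`. -/
theorem exists_isDispersiveFlow_of_tendsto {a t : ℝ} {F u : ℝ → ℂ} {u₀ : 𝓢'(ℝ, ℂ)}
    (hF : HasFourierDensity u₀ F) (hu : Continuous u) {M : ℝ}
    (hM : ∀ (n : ℕ) (x : ℝ), ‖truncatedFlow a t F n x‖ ≤ M)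
    (hlim : ∀ x, Tendsto (fun n : ℕ => truncatedFlow a t F n x) atTop (𝓝 (u x))) :
    ∃ v : 𝓢'(ℝ, ℂ), IsDispersiveFlow a t u₀ v ∧ IsRepresentedBy v u := by
  have huM : ∀ x, ‖u x‖ ≤ M := fun x =>
    le_of_tendsto (hlim x).norm (Eventually.of_forall fun n => hM n x)
  have hmem : MemLp u ∞ volume :=
    memLp_top_of_bound hu.aestronglyMeasurable M (Eventually.of_forall huM)
  set v : 𝓢'(ℝ, ℂ) := Lp.toTemperedDistribution (hmem.toLp u) with hv
  have hvapp : ∀ φ : 𝓢(ℝ, ℂ), v φ = ∫ x, φ x * u x := by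
    intro φ
    rw [hv, Lp.toTemperedDistribution_apply]
    refine integral_congr_ae ?_
    filter_upwards [hmem.coeFn_toLp] with x hx
    rw [hx, smul_eq_mul]
  set q : ℝ → ℂ := fun ξ =>
    Complex.exp (Complex.I * ((t * |2 * Real.pi * ξ| ^ a : ℝ) : ℂ)) * F ξ with hq
  have hqm : Measurable fun ξ : ℝ =>
    Complex.exp (Complex.I * ((t * |2 * Real.pi * ξ| ^ a : ℝ) : ℂ)) := by fun_prop
  have hqn : ∀ ξ : ℝ, ‖Complex.exp (Complex.I * ((t * |2 * Real.pi * ξ| ^ a : ℝ) : ℂ))‖ = 1 :=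
    fun ξ => by rw [mul_comm, Complex.norm_exp_ofReal_mul_I]
  have hint : ∀ φ : 𝓢(ℝ, ℂ), Integrable fun ξ => φ ξ * q ξ := by
    intro φ
    have := (hF.integrable φ).bdd_mul (c := 1) hqm.aestronglyMeasurable
      (Eventually.of_forall fun ξ => (hqn ξ).le)
    refine this.congr (Eventually.of_forall fun ξ => ?_)
    simp only [hq]
    ring
  refine ⟨v, ⟨F, hF, ?_, hint, fun φ => ?_⟩, hu.locallyIntegrable, fun φ => ?_, hvapp⟩
  · intro x
    obtain ⟨s, hs, hFs⟩ := hF.locallyIntegrable x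
    exact ⟨s, hs, hFs.bdd_mul (c := 1) hqm.aestronglyMeasurable
      (Eventually.of_forall fun ξ => (hqn ξ).le)⟩
  · rw [TemperedDistribution.fourier_apply, hvapp]
    have h1 : Tendsto (fun n : ℕ => ∫ x, (𝓕 φ) x * truncatedFlow a t F n x) atTop
        (𝓝 (∫ x, (𝓕 φ) x * u x)) := by
      refine tendsto_integral_of_dominated_convergence (fun x => ‖(𝓕 φ) x‖ * M)
        (fun n => ?_) ((𝓕 φ).integrable.norm.mul_const M) (fun n => ?_) ?_
      · exact ((𝓕 φ).continuous.mul
          (continuous_truncatedFlow hF.locallyIntegrable a t n.cast_nonneg)).aestronglyMeasurable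
      · refine Eventually.of_forall fun x => ?_
        rw [norm_mul]
        exact mul_le_mul_of_nonneg_left (hM n x) (norm_nonneg _)
      · exact Eventually.of_forall fun x => (hlim x).const_mul _
    have h2 : Tendsto (fun n : ℕ => ∫ ξ, φ ξ * (Ioc (-(n : ℝ)) n).indicator q ξ) atTop
        (𝓝 (∫ ξ, φ ξ * q ξ)) := by
      refine tendsto_integral_of_dominated_convergence (fun ξ => ‖φ ξ * q ξ‖)
        (fun n => ?_) (hint φ).norm (fun n => ?_) ?_
      · exact φ.continuous.aestronglyMeasurable.mul
          (integrable_indicator_flow hF.locallyIntegrable a t n).aestronglyMeasurable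
      · refine Eventually.of_forall fun ξ => ?_
        rw [norm_mul, norm_mul]
        exact mul_le_mul_of_nonneg_left (norm_indicator_le_norm_self _ _) (norm_nonneg _)
      · refine Eventually.of_forall fun ξ => ?_
        refine tendsto_const_nhds.congr' ?_
        obtain ⟨n₀, hn₀⟩ := exists_nat_gt |ξ|
        filter_upwards [eventually_ge_atTop n₀] with n hn
        have h3 : |ξ| < n := hn₀.trans_le (by exact_mod_cast hn)
        rw [indicator_of_mem]
        exact ⟨(abs_lt.1 h3).1, (abs_lt.1 h3).2.le⟩
    refine tendsto_nhds_unique h1 (h2.congr fun n => ?_)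
    exact (integral_fourier_mul_truncatedFlow hF.locallyIntegrable a t n.cast_nonneg φ).symm
  · exact φ.integrable.mul_bdd (c := M) hu.aestronglyMeasurable (Eventually.of_forall huM)

end

/-! ### Weak derivatives and Fourier densities -/

section

open Set intervalIntegral Filter
open scoped Topology ContDiff

theorem exists_Icc_superset_tsupport {g : ℝ → ℝ} (hg : HasCompactSupport g) :
    ∃ R : ℝ, 0 < R ∧ ∀ x, x ∉ Ioo (-R) R → g x = 0 := by
  obtain ⟨R, hR⟩ := hg.isBounded.subset_ball 0
  refine ⟨max R 1, by positivity, fun x hx => ?_⟩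
  by_contra h
  have h1 := hR (subset_tsupport g h)
  rw [Real.ball_eq_Ioo, zero_sub, zero_add] at h1
  exact hx ⟨(neg_le_neg (le_max_left _ _)).trans_lt h1.1, h1.2.trans_le (le_max_left _ _)⟩

/-- A test function of integral zero is the derivative of a test function. -/
theorem exists_compactSupport_antideriv {g : ℝ → ℝ} (hg : ContDiff ℝ ∞ g)
    (hc : HasCompactSupport g) (h0 : ∫ x, g x = 0) :
    ∃ ψ : ℝ → ℝ, ContDiff ℝ ∞ ψ ∧ HasCompactSupport ψ ∧ deriv ψ = g := by
  obtain ⟨R, hR, hsupp⟩ := exists_Icc_superset_tsupport hc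
  have hcont := hg.continuous
  have hder : ∀ x, HasDerivAt (fun x => ∫ y in (-R)..x, g y) (g x) x := fun x =>
    integral_hasDerivAt_right (hcont.intervalIntegrable _ _)
      hcont.aestronglyMeasurable.stronglyMeasurableAtFilter hcont.continuousAt
  have hd : deriv (fun x => ∫ y in (-R)..x, g y) = g := funext fun x => (hder x).deriv
  refine ⟨fun x => ∫ y in (-R)..x, g y, ?_, ?_, hd⟩
  · rw [contDiff_infty_iff_deriv, hd]
    exact ⟨fun x => (hder x).differentiableAt, hg⟩
  · have hz : ∀ α β : ℝ, (∀ x ∈ uIcc α β, x ∉ Ioo (-R) R) → ∫ y in α..β, g y = 0 := by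
      intro α β h
      rw [integral_congr (g := fun _ => 0) fun x hx => hsupp x (h x hx)]
      simp
    have htot : ∫ y in (-R)..R, g y = 0 := by
      rw [integral_of_le (by linarith), ← h0]
      refine setIntegral_eq_integral_of_forall_compl_eq_zero fun x hx => hsupp x fun h => hx ?_
      exact ⟨h.1, h.2.le⟩
    refine HasCompactSupport.intro (isCompact_Icc (a := -R) (b := R)) fun x hx => ?_
    rcases lt_or_ge x (-R) with h | h
    · refine hz _ _ fun y hy hy' => ?_
      rw [uIcc_of_ge h.le] at hy
      exact absurd hy'.1 (not_lt.2 hy.2)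
    · have h2 : R < x := by
        by_contra h3
        exact hx ⟨h, not_lt.1 h3⟩
      rw [← integral_add_adjacent_intervals (hcont.intervalIntegrable (-R) R)
        (hcont.intervalIntegrable R x), htot, zero_add]
      refine hz _ _ fun y hy hy' => ?_
      rw [uIcc_of_le h2.le] at hy
      exact absurd hy'.2 (not_lt.2 hy.1)

theorem integral_deriv_smul_primitive {ψ : ℝ → ℝ} (hψ : ContDiff ℝ ∞ ψ) (hc : HasCompactSupport ψ)
    {h : ℝ → ℂ} (hh : LocallyIntegrable h volume) :
    ∫ x, deriv ψ x • (∫ y in (0 : ℝ)..x, h y) = -∫ x, ψ x • h x := by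
  obtain ⟨R, hR, hsupp⟩ := exists_Icc_superset_tsupport hc
  obtain ⟨R', hR', hsupp'⟩ := exists_Icc_superset_tsupport hc.deriv
  set S := max R R' with hS
  have hS0 : 0 < S := hR.trans_le (le_max_left _ _)
  have hle : -S ≤ S := by linarith
  have hψz : ∀ x, x ∉ Ioo (-S) S → ψ x = 0 := fun x hx => hsupp x fun h => hx
    ⟨(neg_le_neg (le_max_left _ _)).trans_lt h.1, h.2.trans_le (le_max_left _ _)⟩
  have hψz' : ∀ x, x ∉ Ioo (-S) S → deriv ψ x = 0 := fun x hx => hsupp' x fun h => hx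
    ⟨(neg_le_neg (le_max_right _ _)).trans_lt h.1, h.2.trans_le (le_max_right _ _)⟩
  have hloc : ∀ α β : ℝ, IntervalIntegrable h volume α β := fun α β =>
    (hh.integrableOn_isCompact isCompact_uIcc).intervalIntegrable
  have hcut : ∀ (w : ℝ → ℝ) (z : ℝ → ℂ), (∀ x, x ∉ Ioo (-S) S → w x = 0) →
      ∫ x, w x • z x = ∫ x in (-S)..S, (w x : ℂ) * z x := by
    intro w z hw
    rw [integral_of_le hle]
    simp only [Complex.real_smul]
    refine (setIntegral_eq_integral_of_forall_compl_eq_zero fun x hx => ?_).symm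
    rw [hw x fun h => hx ⟨h.1, h.2.le⟩]
    simp
  have hψd : Differentiable ℝ ψ := hψ.differentiable (by simp)
  have hcd : Continuous (deriv ψ) := hψ.continuous_deriv (by simp)
  have ibp := integral_deriv_mul_of_primitive hle (w := fun x => (ψ x : ℂ))
    (w' := fun x => ((deriv ψ x : ℝ) : ℂ)) (g := h) (H := fun x => ∫ y in (0 : ℝ)..x, h y)
    (fun x _ => (hψd x).hasDerivAt.ofReal_comp)
    ((Complex.continuous_ofReal.comp hcd).intervalIntegrable _ _) (hloc _ _)
    (fun x _ => (integral_add_adjacent_intervals (hloc _ _) (hloc _ _)).symm)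
  rw [hcut _ _ hψz', hcut _ _ hψz, ibp, hψz S (by simp), hψz (-S) (by simp)]
  simp

/-- A locally integrable function with a locally integrable weak derivative is a.e. equal to a
primitive of it. -/
theorem exists_ae_eq_primitive {H h : ℝ → ℂ} (hH : LocallyIntegrable H volume)
    (hh : LocallyIntegrable h volume)
    (hw : ∀ ψ : ℝ → ℝ, ContDiff ℝ ∞ ψ → HasCompactSupport ψ →
      ∫ x, deriv ψ x • H x = -∫ x, ψ x • h x) :
    ∃ c : ℂ, ∀ᵐ x, H x = c + ∫ y in (0 : ℝ)..x, h y := by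
  have hprim : Continuous fun x => ∫ y in (0 : ℝ)..x, h y :=
    continuous_primitive (fun α β =>
      (hh.integrableOn_isCompact isCompact_uIcc).intervalIntegrable) 0
  set K : ℝ → ℂ := fun x => H x - ∫ y in (0 : ℝ)..x, h y with hK
  have hKloc : LocallyIntegrable K volume := hH.sub hprim.locallyIntegrable
  have hint : ∀ {g : ℝ → ℝ} {L : ℝ → ℂ}, Continuous g → HasCompactSupport g →
      LocallyIntegrable L volume → Integrable fun x => g x • L x := fun hg hgc hL =>
    hL.integrable_smul_left_of_hasCompactSupport hg hgc
  have hK0 : ∀ ψ : ℝ → ℝ, ContDiff ℝ ∞ ψ → HasCompactSupport ψ → ∫ x, deriv ψ x • K x = 0 := by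
    intro ψ hψ hψc
    have hcd : Continuous (deriv ψ) := hψ.continuous_deriv (by simp)
    simp only [hK, smul_sub]
    rw [integral_sub (hint hcd hψc.deriv hH) (hint hcd hψc.deriv hprim.locallyIntegrable),
      hw ψ hψ hψc, integral_deriv_smul_primitive hψ hψc hh, sub_self]
  -- A bump function `θ` of integral one gives the constant `c = ∫ θ K`.
  let b : ContDiffBump (0 : ℝ) := ⟨1, 2, one_pos, one_lt_two⟩
  set θ : ℝ → ℝ := b.normed volume with hθ
  have hθd : ContDiff ℝ ∞ θ := b.contDiff_normed
  have hθc : HasCompactSupport θ := b.hasCompactSupport_normed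
  have hθ1 : ∫ x, θ x = 1 := b.integral_normed
  set c : ℂ := ∫ x, θ x • K x with hc
  refine ⟨c, ?_⟩
  have hae := ae_eq_of_integral_contDiff_smul_eq hKloc
    (locallyIntegrable_const c) fun g hg hgc => ?_
  · filter_upwards [hae] with x hx
    rw [← hx, hK]
    ring
  -- A test function `g` differs from `(∫ g) θ` by a derivative, on which `K` vanishes weakly.
  · set m := ∫ x, g x with hm
    have hg' : ContDiff ℝ ∞ fun x => g x - m * θ x := hg.sub (contDiff_const.mul hθd)
    have hmθc : HasCompactSupport fun x => m * θ x := hθc.mul_left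
    have hgi : Integrable g := hg.continuous.integrable_of_hasCompactSupport hgc
    have hθi : Integrable θ := hθd.continuous.integrable_of_hasCompactSupport hθc
    obtain ⟨ψ, hψ, hψc, hψd⟩ := exists_compactSupport_antideriv hg' (hgc.sub hmθc) (by
      rw [MeasureTheory.integral_sub hgi (hθi.const_mul m), MeasureTheory.integral_const_mul, hθ1]
      simp [hm])
    have h1 := hK0 ψ hψ hψc
    rw [hψd] at h1
    have h2 : ∀ x, (g x - m * θ x) • K x = g x • K x - m • (θ x • K x) := fun x => by
      rw [sub_smul, mul_smul]
    simp only [h2] at h1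
    have hmθK : Integrable fun x => m • (θ x • K x) := (hint hθd.continuous hθc hKloc).smul m
    rw [MeasureTheory.integral_sub (hint hg.continuous hgc hKloc) hmθK,
      MeasureTheory.integral_smul, sub_eq_zero] at h1
    rw [h1, ← hc, _root_.integral_smul_const]

theorem IsRepresentedBy.integral_smul_eq {u : 𝓢'(ℝ, ℂ)} {F : ℝ → ℂ} (hF : IsRepresentedBy u F)
    {g : ℝ → ℝ} (hg : ContDiff ℝ ∞ g) (hc : HasCompactSupport g) :
    ∃ φ : 𝓢(ℝ, ℂ), (∀ x, φ x = g x) ∧ u φ = ∫ x, g x • F x := by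
  have h1 : ContDiff ℝ ∞ fun x => (g x : ℂ) := Complex.ofRealCLM.contDiff.comp hg
  have h2 : HasCompactSupport fun x => (g x : ℂ) := hc.comp_left (g := fun y : ℝ => (y : ℂ)) (by simp)
  refine ⟨h2.toSchwartzMap h1, fun x => rfl, ?_⟩
  rw [hF.apply_eq]
  rfl

theorem IsRepresentedBy.ae_eq {u : 𝓢'(ℝ, ℂ)} {F F' : ℝ → ℂ} (hF : IsRepresentedBy u F)
    (hF' : IsRepresentedBy u F') : F =ᵐ[volume] F' := by
  refine ae_eq_of_integral_contDiff_smul_eq hF.locallyIntegrable hF'.locallyIntegrable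
    fun g hg hc => ?_
  obtain ⟨φ, h1, h2⟩ := hF.integral_smul_eq hg hc
  rw [← h2, hF'.apply_eq]
  simp only [h1, Complex.real_smul]

theorem IsRepresentedBy.congr_ae {u : 𝓢'(ℝ, ℂ)} {F F' : ℝ → ℂ} (hF : IsRepresentedBy u F)
    (h : F =ᵐ[volume] F') : IsRepresentedBy u F' where
  locallyIntegrable := hF.locallyIntegrable.congr h
  integrable φ := (hF.integrable φ).congr (by filter_upwards [h] with x hx; rw [hx])
  apply_eq φ := by
    rw [hF.apply_eq]
    exact integral_congr_ae (by filter_upwards [h] with x hx; rw [hx])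

/-- Densities are unique up to null sets, so any of them computes the Sobolev norm. -/
theorem HasFourierDensity.homSobolevENorm_eq {u : 𝓢'(ℝ, ℂ)} {F : ℝ → ℂ} (hF : HasFourierDensity u F)
    (s : ℝ) : homSobolevENorm s u
      = eLpNorm (fun ξ : ℝ => ((|2 * Real.pi * ξ| ^ s : ℝ) : ℂ) * F ξ) 2 volume := by
  refine le_antisymm (iInf₂_le F hF) (le_iInf₂ fun F' hF' => le_of_eq (eLpNorm_congr_ae ?_))
  filter_upwards [hF.ae_eq hF'] with ξ hξ
  rw [hξ]

theorem MemHomSobolev.exists_hasFourierDensity {s : ℝ} {u : 𝓢'(ℝ, ℂ)} (hu : MemHomSobolev s u) :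
    ∃ F, HasFourierDensity u F := by
  obtain ⟨F, hF⟩ := iInf_lt_iff.1 hu
  obtain ⟨h, -⟩ := iInf_lt_iff.1 hF
  exact ⟨F, h⟩

open LineDeriv in
/-- On the Fourier side the operator `x ∂ₓ` becomes `-∂_ξ ξ`. -/
theorem fourier_mul_deriv (ψ : 𝓢(ℝ, ℂ)) :
    𝓕 (SchwartzMap.smulLeftCLM ℂ (fun x : ℝ => (x : ℂ)) (SchwartzMap.derivCLM ℂ ℂ ψ))
      = -SchwartzMap.derivCLM ℂ ℂ (SchwartzMap.smulLeftCLM ℂ (fun x : ℝ => (x : ℂ)) (𝓕 ψ)) := by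
  have hd : ∀ χ : 𝓢(ℝ, ℂ), SchwartzMap.derivCLM ℂ ℂ χ = ∂_{(1 : ℝ)} χ := by
    intro χ
    ext x
    rw [SchwartzMap.derivCLM_apply, SchwartzMap.lineDerivOp_apply_eq_fderiv]
    simp
  have hm : ∀ χ : 𝓢(ℝ, ℂ), SchwartzMap.smulLeftCLM ℂ (fun x : ℝ => (x : ℂ)) χ
      = SchwartzMap.smulLeftCLM ℂ (inner ℝ · (1 : ℝ)) χ := by
    intro χ
    ext x
    rw [SchwartzMap.smulLeftCLM_apply_apply (by fun_prop),
      SchwartzMap.smulLeftCLM_apply_apply (by fun_prop)]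
    simp
  have h1 := SchwartzMap.fourier_lineDerivOp_eq ψ (1 : ℝ)
  have h2 := SchwartzMap.lineDerivOp_fourier_eq (∂_{(1 : ℝ)} ψ) (1 : ℝ)
  rw [h1, ← hd, ← hd, ← hm, ← hm, map_smul, neg_smul, FourierTransform.fourier_neg,
    FourierTransform.fourier_smul, ← smul_neg] at h2
  have hpi : (2 * (Real.pi : ℂ) * Complex.I) ≠ 0 := by simp [Real.pi_ne_zero]
  rw [smul_right_injective _ hpi h2, neg_neg]

end

/-! ### The dispersive estimate -/

section

open Set intervalIntegral Filter
open scoped Topology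

theorem HasFourierDensity.apply_scalingField {a : ℝ} {u₀ : 𝓢'(ℝ, ℂ)} {F : ℝ → ℂ}
    (hF : HasFourierDensity u₀ F) (φ : 𝓢(ℝ, ℂ)) :
    (𝓕 (scalingField a u₀)) φ = ((1 / a : ℝ) : ℂ) * ∫ x, (x * deriv φ x) * F x := by
  have h1 : (𝓕 (scalingField a u₀)) φ = ((1 / a : ℝ) : ℂ) • (𝓕 u₀)
      (SchwartzMap.smulLeftCLM ℂ (fun x : ℝ => (x : ℂ)) (SchwartzMap.derivCLM ℂ ℂ φ)) := by
    rw [TemperedDistribution.fourier_apply u₀, fourier_mul_deriv]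
    rfl
  rw [h1, hF.apply_eq, smul_eq_mul]
  congr 2
  ext x
  rw [SchwartzMap.smulLeftCLM_apply_apply (by fun_prop), SchwartzMap.derivCLM_apply, smul_eq_mul]

section WeakDerivative

open scoped ContDiff

/-- Weakly, `∂_ξ (ξ F)` is `-a G` when `F` and `G` are the Fourier transforms of `u₀` and of
`(x / a) ∂ₓ u₀`. -/
theorem HasFourierDensity.integral_deriv_smul {a : ℝ} (ha : a ≠ 0) {u₀ : 𝓢'(ℝ, ℂ)} {F G : ℝ → ℂ}
    (hF : HasFourierDensity u₀ F) (hG : HasFourierDensity (scalingField a u₀) G) {ψ : ℝ → ℝ}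
    (hψ : ContDiff ℝ ∞ ψ) (hc : HasCompactSupport ψ) :
    ∫ x, deriv ψ x • ((x : ℂ) * F x) = -∫ x, ψ x • (-(a : ℂ) * G x) := by
  obtain ⟨φ, hφ, h1⟩ := hG.integral_smul_eq hψ hc
  have hd : ∀ x, deriv φ x = (deriv ψ x : ℝ) := by
    intro x
    have h2 : (φ : ℝ → ℂ) = fun x => (ψ x : ℂ) := funext hφ
    rw [h2]
    exact ((hψ.differentiable (by simp) x).hasDerivAt.ofReal_comp).deriv
  rw [hF.apply_scalingField] at h1
  have h3 : ∫ x, (x * deriv φ x) * F x = ∫ x, deriv ψ x • ((x : ℂ) * F x) := by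
    congr 1
    ext x
    rw [hd, Complex.real_smul]
    ring
  have h4 : ∫ x, ψ x • (-(a : ℂ) * G x) = -(a : ℂ) * ∫ x, ψ x • G x := by
    rw [← MeasureTheory.integral_const_mul]
    congr 1
    ext x
    rw [Complex.real_smul, Complex.real_smul]
    ring
  have ha' : (a : ℂ) ≠ 0 := by exact_mod_cast ha
  rw [h4, ← h1, h3]
  push_cast
  field_simp

end WeakDerivative

/-- Finiteness of the homogeneous Sobolev norm of order `(1 - a) / 2` in terms of the weight
`|ξ| ^ (1 - a)`. -/
theorem integrable_weight_of_eLpNorm {a : ℝ} {F : ℝ → ℂ} (hF : LocallyIntegrable F volume)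
    (hfin : eLpNorm (fun ξ : ℝ => ((|2 * Real.pi * ξ| ^ ((1 - a) / 2) : ℝ) : ℂ) * F ξ) 2 volume < ∞) :
    Integrable (fun ξ : ℝ => |ξ| ^ (1 - a) * ‖F ξ‖ ^ 2) ∧
    ∫ ξ : ℝ, |ξ| ^ (1 - a) * ‖F ξ‖ ^ 2 = (2 * Real.pi) ^ (a - 1) *
      (eLpNorm (fun ξ : ℝ => ((|2 * Real.pi * ξ| ^ ((1 - a) / 2) : ℝ) : ℂ) * F ξ)
        2 volume).toReal ^ 2 := by
  have hpi : (0 : ℝ) < 2 * Real.pi := by positivity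
  set w : ℝ → ℂ := fun ξ => ((|2 * Real.pi * ξ| ^ ((1 - a) / 2) : ℝ) : ℂ) * F ξ with hw
  have hmeas : AEStronglyMeasurable w volume := by
    refine AEStronglyMeasurable.mul (Measurable.aestronglyMeasurable ?_)
      hF.aestronglyMeasurable
    fun_prop
  have hmem : MemLp w 2 volume := ⟨hmeas, hfin⟩
  have hpt : ∀ ξ : ℝ, |ξ| ^ (1 - a) * ‖F ξ‖ ^ 2 = (2 * Real.pi) ^ (a - 1) * ‖w ξ‖ ^ 2 := by
    intro ξ
    have e1 : (|2 * Real.pi * ξ| ^ ((1 - a) / 2)) ^ 2 = (2 * Real.pi) ^ (1 - a) * |ξ| ^ (1 - a) := by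
      rw [← Real.rpow_natCast, ← Real.rpow_mul (abs_nonneg _), abs_mul, abs_of_pos hpi,
        Real.mul_rpow hpi.le (abs_nonneg _)]
      congr 2 <;> push_cast <;> ring
    have e2 : (2 * Real.pi) ^ (a - 1) * (2 * Real.pi) ^ (1 - a) = 1 := by
      rw [← Real.rpow_add hpi]; simp
    rw [hw, norm_mul, Complex.norm_real, Real.norm_eq_abs, mul_pow, sq_abs, e1, ← mul_assoc,
      ← mul_assoc, e2, one_mul]
  have hsq : Integrable fun ξ => ‖w ξ‖ ^ 2 := hmem.integrable_norm_pow (by norm_num)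
  have hval : (eLpNorm w 2 volume).toReal ^ 2 = ∫ ξ, ‖w ξ‖ ^ 2 := by
    have h0 : 0 ≤ ∫ ξ, ‖w ξ‖ ^ 2 := integral_nonneg fun ξ => by positivity
    rw [hmem.eLpNorm_eq_integral_rpow_norm (by norm_num) (by norm_num), ENNReal.toReal_ofReal
      (Real.rpow_nonneg (integral_nonneg fun ξ => by positivity) _)]
    simp only [ENNReal.toReal_ofNat, Real.rpow_ofNat]
    rw [← Real.rpow_natCast, ← Real.rpow_mul h0]
    norm_num
  simp only [hpt]
  exact ⟨hsq.const_mul _, by rw [MeasureTheory.integral_const_mul, hval]⟩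

theorem setIntegral_Ioi_weight_le {s : ℝ} {u : ℝ → ℂ}
    (hu : Integrable fun ξ : ℝ => |ξ| ^ s * ‖u ξ‖ ^ 2) :
    IntegrableOn (fun ξ : ℝ => ξ ^ s * ‖u ξ‖ ^ 2) (Ioi 0) ∧
      ∫ ξ in Ioi 0, ξ ^ s * ‖u ξ‖ ^ 2 ≤ ∫ ξ, |ξ| ^ s * ‖u ξ‖ ^ 2 := by
  have hcongr : EqOn (fun ξ : ℝ => |ξ| ^ s * ‖u ξ‖ ^ 2) (fun ξ : ℝ => ξ ^ s * ‖u ξ‖ ^ 2)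
      (Ioi 0) := fun ξ hξ => by
    have h0 : 0 < ξ := hξ
    simp only [abs_of_pos h0]
  refine ⟨hu.integrableOn.congr_fun hcongr measurableSet_Ioi, ?_⟩
  rw [← setIntegral_congr_fun measurableSet_Ioi hcongr]
  exact setIntegral_le_integral hu (Eventually.of_forall fun ξ => by positivity)

theorem weight_comp_neg {s : ℝ} {u : ℝ → ℂ}
    (hu : Integrable fun ξ : ℝ => |ξ| ^ s * ‖u ξ‖ ^ 2) :
    Integrable (fun ξ : ℝ => |ξ| ^ s * ‖u (-ξ)‖ ^ 2) ∧
      ∫ ξ : ℝ, |ξ| ^ s * ‖u (-ξ)‖ ^ 2 = ∫ ξ, |ξ| ^ s * ‖u ξ‖ ^ 2 := by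
  have h1 := hu.comp_neg
  have h2 := integral_neg_eq_self (fun ξ : ℝ => |ξ| ^ s * ‖u ξ‖ ^ 2) volume
  simp only [abs_neg] at h1 h2
  exact ⟨h1, h2⟩

/-- If `ξ F(ξ)` is a primitive of `h`, then `F` restricts to a profile on the half-line. The constant
`c` need not vanish, because the profile condition only concerns intervals away from the origin. -/
theorem isHalfLineProfile_of_primitive {a : ℝ} {F h : ℝ → ℂ} {c : ℂ}
    (hh : ∀ α β : ℝ, IntervalIntegrable h volume α β)
    (hFh : ∀ ξ : ℝ, ξ ≠ 0 → ξ * F ξ = c + ∫ y in (0 : ℝ)..ξ, h y)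
    (iF : Integrable fun ξ : ℝ => |ξ| ^ (1 - a) * ‖F ξ‖ ^ 2)
    (ih : Integrable fun ξ : ℝ => |ξ| ^ (1 - a) * ‖h ξ‖ ^ 2) : IsHalfLineProfile a F h where
  intervalIntegrable A B _ _ := hh A B
  mul_eq A B hA hAB := by
    rw [hFh A hA.ne', hFh B (hA.trans_le hAB).ne', add_assoc,
      integral_add_adjacent_intervals (hh _ _) (hh _ _)]
  integrableOn_left := (setIntegral_Ioi_weight_le iF).1
  integrableOn_right := (setIntegral_Ioi_weight_le ih).1

theorem tailEnergy_zero_le {a : ℝ} {F h : ℝ → ℂ}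
    (iF : Integrable fun ξ : ℝ => |ξ| ^ (1 - a) * ‖F ξ‖ ^ 2)
    (ih : Integrable fun ξ : ℝ => |ξ| ^ (1 - a) * ‖h ξ‖ ^ 2) :
    tailEnergy a F h 0 ≤ (∫ ξ : ℝ, |ξ| ^ (1 - a) * ‖F ξ‖ ^ 2) + ∫ ξ, |ξ| ^ (1 - a) * ‖h ξ‖ ^ 2 :=
  add_le_add (setIntegral_Ioi_weight_le iF).2 (setIntegral_Ioi_weight_le ih).2

/-- The dispersive estimate, uniformly in space. -/
theorem exists_uniform_dispersive_bound {a : ℝ} (ha : 0 < a) (ha1 : a ≠ 1) :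
    ∃ C : ℝ, 0 < C ∧ ∀ u₀ : 𝓢'(ℝ, ℂ), MemHomSobolev ((1 - a) / 2) u₀ →
      MemHomSobolev ((1 - a) / 2) (scalingField a u₀) → ∀ t : ℝ, 0 < t →
      ∃ u : ℝ → ℂ, Continuous u ∧ (∃ v : 𝓢'(ℝ, ℂ), IsDispersiveFlow a t u₀ v ∧ IsRepresentedBy v u) ∧
        ∀ x, ‖u x‖ ≤ C * t ^ (-(1 / 2) : ℝ) * (homSobolevNorm ((1 - a) / 2) u₀ +
          homSobolevNorm ((1 - a) / 2) (scalingField a u₀)) := by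
  obtain ⟨C, hC, hflow⟩ := exists_flow_limit ha ha1
  have hpi : (0 : ℝ) < 2 * Real.pi := by positivity
  set D := (2 * Real.pi) ^ ((a - 1) / 2) * (1 + a) with hD
  have hD0 : 0 < D := by positivity
  refine ⟨C * D, by positivity, fun u₀ h₀ h₁ t ht => ?_⟩
  obtain ⟨F₀, hF₀⟩ := h₀.exists_hasFourierDensity
  obtain ⟨G, hG⟩ := h₁.exists_hasFourierDensity
  set h : ℝ → ℂ := fun ξ => -(a : ℂ) * G ξ with hh
  have hhl : LocallyIntegrable h volume := hG.locallyIntegrable.smul (-(a : ℂ))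
  have hHl : LocallyIntegrable (fun ξ : ℝ => (ξ : ℂ) * F₀ ξ) volume := by
    rw [← locallyIntegrableOn_univ]
    exact hF₀.locallyIntegrable.locallyIntegrableOn univ |>.continuousOn_mul
      Complex.continuous_ofReal.continuousOn isOpen_univ.isLocallyClosed
  obtain ⟨c, hc⟩ := exists_ae_eq_primitive hHl hhl fun ψ hψ hψc =>
    hF₀.integral_deriv_smul ha.ne' hG hψ hψc
  -- The representative of the Fourier transform of `u₀` for which `ξ F(ξ)` is absolutely continuous.
  set F : ℝ → ℂ := fun ξ => (c + ∫ y in (0 : ℝ)..ξ, h y) / ξ with hFdef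
  have hae : F₀ =ᵐ[volume] F := by
    filter_upwards [hc, Measure.ae_ne volume (0 : ℝ)] with ξ hξ hξ0
    have : (ξ : ℂ) ≠ 0 := by exact_mod_cast hξ0
    rw [hFdef]
    simp only
    rw [← hξ]
    field_simp
  have hF : HasFourierDensity u₀ F := hF₀.congr_ae hae
  have hFmul : ∀ ξ : ℝ, ξ ≠ 0 → ξ * F ξ = c + ∫ y in (0 : ℝ)..ξ, h y := by
    intro ξ hξ0
    have : (ξ : ℂ) ≠ 0 := by exact_mod_cast hξ0
    rw [hFdef]
    field_simp
  have fin₀ := h₀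
  rw [MemHomSobolev, hF.homSobolevENorm_eq] at fin₀
  have fin₁ := h₁
  rw [MemHomSobolev, hG.homSobolevENorm_eq] at fin₁
  obtain ⟨iF, eF⟩ := integrable_weight_of_eLpNorm hF.locallyIntegrable fin₀
  obtain ⟨iG, eG⟩ := integrable_weight_of_eLpNorm hG.locallyIntegrable fin₁
  rw [← hF.homSobolevENorm_eq] at eF
  rw [← hG.homSobolevENorm_eq] at eG
  change _ = _ * homSobolevNorm _ _ ^ 2 at eF eG
  set S₀ := homSobolevNorm ((1 - a) / 2) u₀ with hS₀
  set S₁ := homSobolevNorm ((1 - a) / 2) (scalingField a u₀) with hS₁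
  have hS₀0 : 0 ≤ S₀ := ENNReal.toReal_nonneg
  have hS₁0 : 0 ≤ S₁ := ENNReal.toReal_nonneg
  have hpt : ∀ ξ : ℝ, |ξ| ^ (1 - a) * ‖h ξ‖ ^ 2 = a ^ 2 * (|ξ| ^ (1 - a) * ‖G ξ‖ ^ 2) := by
    intro ξ
    rw [hh, norm_mul, norm_neg, Complex.norm_real, Real.norm_eq_abs, mul_pow, sq_abs]
    ring
  have ih : Integrable fun ξ : ℝ => |ξ| ^ (1 - a) * ‖h ξ‖ ^ 2 := by
    simp only [hpt]
    exact iG.const_mul _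
  have eh : ∫ ξ : ℝ, |ξ| ^ (1 - a) * ‖h ξ‖ ^ 2 = a ^ 2 * ((2 * Real.pi) ^ (a - 1) * S₁ ^ 2) := by
    simp only [hpt]
    rw [MeasureTheory.integral_const_mul, eG]
  obtain ⟨iF', eF'⟩ := weight_comp_neg iF
  obtain ⟨ih', eh'⟩ := weight_comp_neg ih
  have hhi : ∀ α β : ℝ, IntervalIntegrable h volume α β := fun α β =>
    (hhl.integrableOn_isCompact isCompact_uIcc).intervalIntegrable
  have hp : IsHalfLineProfile a F h := isHalfLineProfile_of_primitive hhi hFmul iF ih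
  have hhi' : ∀ α β : ℝ, IntervalIntegrable (fun ξ => h (-ξ)) volume α β := fun α β => by
    simpa using (hhi (-α) (-β)).comp_sub_left 0
  have hm : IsHalfLineProfile a (fun ξ => F (-ξ)) (fun ξ => h (-ξ)) := by
    refine isHalfLineProfile_of_primitive (c := -c) hhi' (fun ξ hξ => ?_) iF' ih'
    have h1 := hFmul (-ξ) (neg_ne_zero.2 hξ)
    have h2 : ∫ y in (0 : ℝ)..ξ, h (-y) = -∫ y in (0 : ℝ)..(-ξ), h y := by
      rw [intervalIntegral.integral_comp_neg, neg_zero, integral_symm]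
    rw [h2, ← neg_add, ← h1]
    push_cast
    ring
  obtain ⟨u, hu, ⟨M, hM⟩, hlim, hbd⟩ := hflow F h hF.locallyIntegrable hp hm t ht
  refine ⟨u, hu, exists_isDispersiveFlow_of_tendsto hF hu hM hlim, fun x => ?_⟩
  have hS : ∀ S, S₀ + S₁ < S → ‖u x‖ ≤ C * t ^ (-(1 / 2) : ℝ) * (D * S) := by
    intro S hSlt
    have hS0 : 0 < S := by linarith
    have hE : (2 * Real.pi) ^ (a - 1) * S₀ ^ 2 + a ^ 2 * ((2 * Real.pi) ^ (a - 1) * S₁ ^ 2)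
        ≤ (D * S) ^ 2 := by
      have e1 : ((2 * Real.pi) ^ ((a - 1) / 2)) ^ 2 = (2 * Real.pi) ^ (a - 1) := by
        rw [← Real.rpow_natCast, ← Real.rpow_mul hpi.le]; congr 1; push_cast; ring
      have e2 : S₀ ^ 2 + a ^ 2 * S₁ ^ 2 ≤ ((1 + a) * S) ^ 2 := by
        have e3 : S₀ + a * S₁ ≤ (1 + a) * S := by nlinarith
        have e4 : 0 ≤ S₀ * (a * S₁) := by positivity
        have e5 := pow_le_pow_left₀ (by positivity) e3 2
        nlinarith
      rw [hD, mul_assoc, mul_pow, e1]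
      have e6 := mul_le_mul_of_nonneg_left e2 (show 0 ≤ (2 * Real.pi) ^ (a - 1) by positivity)
      linarith
    refine hbd (D * S) (by positivity) ((tailEnergy_zero_le iF ih).trans ?_)
      ((tailEnergy_zero_le iF' ih').trans ?_) x
    · rw [eF, eh]; exact hE
    · rw [eF', eh', eF, eh]; exact hE
  -- The estimates above need a positive bound for the energy, and `S₀ + S₁` may vanish.
  have hcont : Tendsto (fun S => C * t ^ (-(1 / 2) : ℝ) * (D * S)) (𝓝[>] (S₀ + S₁))
      (𝓝 (C * t ^ (-(1 / 2) : ℝ) * (D * (S₀ + S₁)))) :=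
    ((tendsto_id.const_mul D).const_mul _).mono_left nhdsWithin_le_nhds
  refine (ge_of_tendsto hcont (eventually_mem_nhdsWithin.mono hS)).trans (le_of_eq ?_)
  ring

end

theorem mainTheorem1 (a : ℝ) (ha : 0 < a) (ha1 : a ≠ 1) :
    ∃ C : ℝ, 0 < C ∧
      ∀ u₀ : 𝓢'(ℝ, ℂ),
        MemHomSobolev ((1 - a) / 2) u₀ →
        MemHomSobolev ((1 - a) / 2) (scalingField a u₀) →
        ∃ u : ℝ → ℝ → ℂ,
          ∀ t : ℝ, 0 < t →
            Continuous (u t) ∧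
            (∃ v : 𝓢'(ℝ, ℂ), IsDispersiveFlow a t u₀ v ∧ IsRepresentedBy v (u t)) ∧
            ∀ y : ℝ, (a < 1 → y ≠ 0) →
              ‖u t (y * t ^ (1 / a))‖ ≤
                C * (1 + |y| ^ (-a / (4 * (1 - a)))) * t ^ (-(1 / 2) : ℝ) *
                  (homSobolevNorm ((1 - a) / 2) u₀ +
                    homSobolevNorm ((1 - a) / 2) (scalingField a u₀)) := by
  obtain ⟨C, hC, hbound⟩ := exists_uniform_dispersive_bound ha ha1
  refine ⟨C, hC, fun u₀ h₀ h₁ => ?_⟩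
  choose! u hu using hbound u₀ h₀ h₁
  refine ⟨u, fun t ht => ⟨(hu t ht).1, (hu t ht).2.1, fun y _ => ?_⟩⟩
  have hS : 0 ≤ homSobolevNorm ((1 - a) / 2) u₀ +
      homSobolevNorm ((1 - a) / 2) (scalingField a u₀) :=
    add_nonneg ENNReal.toReal_nonneg ENNReal.toReal_nonneg
  refine ((hu t ht).2.2 _).trans ?_
  have hy : 0 ≤ |y| ^ (-a / (4 * (1 - a))) := by positivity
  gcongr
  nlinarith
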